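/- Let $\Sigma$ be a finite alphabet. Formulas over $\Sigma$ are built by $\varphi ::= \bot \mid p_i \mid \varphi\to\psi \mid [e]\varphi$ ($i<\omega$, $e\in\Sigma$) and are interpreted in the usual way in Kripke models $M=(W,(R_e)_{e\in\Sigma},V)$ with $W\neq\varnothing$. A *logic* over $\Sigma$ is a set of formulas that contains all classical tautologies and the formulas $[e](p\to q)\to([e]p\to[e]q)$ and is closed under modus ponens, substitution and necessitation for each $[e]$. $\mathsf{Mod}(L)$ is the class of models in which all formulas of $L$ are true at all points. For a model $M$ and a set of formulas $\Phi$, write $x\sim_\Phi y$ if $x$ and $y$ satisfy the same formulas of $\Phi$ in $M$. Let $\Gamma$ be a finite set of formulas closed under subformulas. A *definable $\Gamma$-filtration* of $M$ is a model $\widehat M=(W/{\sim},(\widehat R_e)_{e\in\Sigma},\widehat V)$ such that ${\sim}={\sim_\Phi}$ for some finite set $\Phi$ of formulas; ${\sim}\subseteq{\sim_\Gamma}$; for all letters $p\in\Gamma$ and $x\in W$, $\widehat M,[x]\models p$ iff $M,x\models p$; $xR_ey$ implies $[x]\widehat R_e[y]$; and whenever $[x]\widehat R_e[y]$, $[e]\varphi\in\Gamma$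 and $M,x\models[e]\varphi$, then $M,y\models\varphi$. A class $\mathcal M$ of models *admits definable filtration* if for every finite subformula-closed $\Gamma$, every $M\in\mathcal M$ has a definable $\Gamma$-filtration that belongs to $\mathcal M$. Let $\Sigma^\sharp$ be $\Sigma$ together with new symbols $e\circ c$, $e\cup c$, $e^+$ for all $e,c\in\Sigma$. For a logic $L$ over $\Sigma$, let $L^\sharp$ be the smallest logic over $\Sigma^\sharp$ that contains $L$ and, for all $e,c\in\Sigma$, the formulas $$[e\cup c]p\leftrightarrow[e]p\wedge[c]p,\qquad [e\circ c]p\leftrightarrow[e][c]p,$$ $$[e^+]p\to[e]p,\qquad [e^+]p\to[e][e^+]p,\qquad [e^+](p\to[e]p)\to([e]p\to[e^+]p).$$ Put $L^{(0)}=L$ and $L^{(n+1)}=(L^{(n)})^\sharp$. **Theorem.** Let $L$ be a logic over a finite alphabet $\Sigma$ such that $\mathsf{Mod}(L)$ admits definable filtration. Then for every $n<\omega$: 1. $\mathsf{Mod}(L^{(n)})$ admits definable filtration. 2. $L^{(n)}$ has the finite model property (it is the set of formulas valid in all frames of some class of finite frames), and hence is Kripke complete (it is the set of formulas valid in all frames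 of some class of frames). 3. If $L$ is finitely axiomatizable (it is the smallest logic over $\Sigma$ that contains some finite set of formulas), then $L^{(n)}$ is decidable. 4. If the class of finite $L$-frames is decidable (there is an algorithm that decides, given a finite frame $(W,(R_e)_{e\in\Sigma})$, whether all formulas of $L$ are valid in it), then $L^{(n)}$ is co-recursively enumerable. -/

import Mathlib

universe u

namespace ModalLogic

/-- Modal formulas over an alphabet `S`: `⊥ | pᵢ | φ → ψ | [e]φ`. -/
inductive Formula (S : Type) : Type
  | bot : Formula S
  | var : ℕ → Formula S
  | imp : Formula S → Formula S → Formula S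
  | box : S → Formula S → Formula S

namespace Formula

variable {S T : Type}

/-- `¬ φ` -/
def neg (φ : Formula S) : Formula S := imp φ bot

/-- `φ ∧ ψ` -/
def and (φ ψ : Formula S) : Formula S := neg (imp φ (neg ψ))

/-- `φ ↔ ψ` -/
def iff (φ ψ : Formula S) : Formula S := and (imp φ ψ) (imp ψ φ)

/-- Uniform substitution of formulas for the propositional letters. -/
def subst (σ : ℕ → Formula S) : Formula S → Formula S
  | bot => bot
  | var i => σ i
  | imp φ ψ => imp (subst σ φ) (subst σ ψ)
  | box e φ => box e (subst σ φ)

/-- Renaming of the modalities along a map of alphabets. -/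
def mapAlphabet (f : S → T) : Formula S → Formula T
  | bot => bot
  | var i => var i
  | imp φ ψ => imp (mapAlphabet f φ) (mapAlphabet f ψ)
  | box e φ => box (f e) (mapAlphabet f φ)

/-- The set of all subformulas of a formula. -/
def sub : Formula S → Set (Formula S)
  | bot => {bot}
  | var i => {var i}
  | imp φ ψ => {imp φ ψ} ∪ sub φ ∪ sub ψ
  | box e φ => {box e φ} ∪ sub φ

/-- A (classical) tautology: true under every Boolean truth assignment, where letters and
boxed formulas are treated as atoms. -/
def IsTautology (φ : Formula S) : Prop :=
  ∀ v : Formula S → Prop, ¬ v bot → (∀ ψ χ, v (imp ψ χ) ↔ (v ψ → v χ)) → v φ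

/-- Gödel number of a formula, relative to a numbering `ι` of the alphabet. -/
def code (ι : S → ℕ) : Formula S → ℕ
  | bot => Nat.pair 0 0
  | var i => Nat.pair 1 i
  | imp φ ψ => Nat.pair 2 (Nat.pair (code ι φ) (code ι ψ))
  | box e φ => Nat.pair 3 (Nat.pair (ι e) (code ι φ))

theorem code_injective {ι : S → ℕ} (hι : Function.Injective ι) :
    Function.Injective (code ι) := by
  intro φ
  induction φ with
  | bot => intro ψ h; cases ψ <;> simp [code, Nat.pair_eq_pair] at h ⊢
  | var i => intro ψ h; cases ψ <;> simp [code, Nat.pair_eq_pair] at h ⊢; exact h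
  | imp a b iha ihb =>
    intro ψ h
    cases ψ <;> simp [code, Nat.pair_eq_pair] at h ⊢
    exact ⟨iha h.1, ihb h.2⟩
  | box e a iha =>
    intro ψ h
    cases ψ <;> simp [code, Nat.pair_eq_pair] at h ⊢
    exact ⟨hι h.1, iha h.2⟩

end Formula

open Formula

/-- `Γ` contains every subformula of each of its members. -/
def SubClosed {S : Type} (Γ : Set (Formula S)) : Prop :=
  ∀ φ ∈ Γ, sub φ ⊆ Γ

/-! ### Logics -/

/-- Normal modal logics over the alphabet `S`. -/
structure IsNormalLogic {S : Type} (L : Set (Formula S)) : Prop where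
  taut : ∀ φ, IsTautology φ → φ ∈ L
  axiomK : ∀ e : S,
    imp (box e (imp (var 0) (var 1))) (imp (box e (var 0)) (box e (var 1))) ∈ L
  mp : ∀ φ ψ, imp φ ψ ∈ L → φ ∈ L → ψ ∈ L
  subst : ∀ (σ : ℕ → Formula S) (φ), φ ∈ L → φ.subst σ ∈ L
  nec : ∀ (e : S) (φ), φ ∈ L → box e φ ∈ L

/-- The smallest normal logic that contains `A`. -/
def smallestLogic {S : Type} (A : Set (Formula S)) : Set (Formula S) :=
  {φ | ∀ L : Set (Formula S), IsNormalLogic L → A ⊆ L → φ ∈ L}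

theorem isNormalLogic_smallestLogic {S : Type} (A : Set (Formula S)) :
    IsNormalLogic (smallestLogic A) where
  taut φ h _ hL _ := hL.taut φ h
  axiomK e _ hL _ := hL.axiomK e
  mp φ ψ h h' L hL hA := hL.mp φ ψ (h L hL hA) (h' L hL hA)
  subst σ φ h L hL hA := hL.subst σ φ (h L hL hA)
  nec e φ h L hL hA := hL.nec e φ (h L hL hA)

/-- `L` is the smallest normal logic that contains some finite set of formulas. -/
def FinitelyAxiomatizable {S : Type} (L : Set (Formula S)) : Prop :=
  ∃ A : Set (Formula S), A.Finite ∧ L = smallestLogic A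

/-! ### Frames and models -/

/-- Kripke frames over the alphabet `S` with (non-empty) set of points `W`. -/
structure Frame (S : Type) (W : Type u) where
  nonempty : Nonempty W
  rel : S → W → W → Prop

/-- Kripke models over the alphabet `S` with (non-empty) set of points `W`. -/
structure Model (S : Type) (W : Type u) extends Frame S W where
  val : ℕ → W → Prop

variable {S : Type} {W : Type u}

/-- The truth relation `M, x ⊨ φ`. -/
def Model.Sat (M : Model S W) : W → Formula S → Prop
  | _, .bot => False
  | x, .var i => M.val i x
  | x, .imp φ ψ => M.Sat x φ → M.Sat x ψ
  | x, .box e φ => ∀ y, M.rel e x y → M.Sat y φ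

/-- `M ⊨ φ` for all `φ ∈ L`. -/
def Model.Models (M : Model S W) (L : Set (Formula S)) : Prop :=
  ∀ φ ∈ L, ∀ x, M.Sat x φ

/-- `F ⊨ φ`: the formula `φ` is true at all points under all valuations on `F`. -/
def Frame.Valid (F : Frame S W) (φ : Formula S) : Prop :=
  ∀ (V : ℕ → W → Prop) (x : W), (Model.mk F V).Sat x φ

/-- `L` is the set of formulas that are valid in all members of some class of frames. -/
def KripkeComplete (L : Set (Formula S)) : Prop :=
  ∃ C : ∀ W : Type u, Set (Frame S W),
    L = {φ | ∀ (W : Type u) (F : Frame S W), F ∈ C W → F.Valid φ}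

/-- Finite model property: `L` is the set of formulas that are valid in all members of some
class of finite frames. -/
def HasFMP (L : Set (Formula S)) : Prop :=
  ∃ C : ∀ W : Type u, Set (Frame S W),
    (∀ W : Type u, (C W).Nonempty → Finite W) ∧
    L = {φ | ∀ (W : Type u) (F : Frame S W), F ∈ C W → F.Valid φ}

/-! ### Filtrations -/

/-- The equivalence relation on the points of `M` induced by a set of formulas. -/
def Model.equivOn (M : Model S W) (Γ : Set (Formula S)) : Setoid W where
  r x y := ∀ φ ∈ Γ, (M.Sat x φ ↔ M.Sat y φ)
  iseqv :=
    { refl := fun _ _ _ => Iff.rfl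
      symm := fun h φ hφ => (h φ hφ).symm
      trans := fun h h' φ hφ => (h φ hφ).trans (h' φ hφ) }

/-- `N` is a filtration of `M` with quotient set `W/s` that respects `Γ`. -/
structure IsFiltration (M : Model S W) (Γ : Set (Formula S)) (s : Setoid W)
    (N : Model S (Quotient s)) : Prop where
  finite_index : Finite (Quotient s)
  respects : ∀ x y, s x y → M.equivOn Γ x y
  val_iff : ∀ i, Formula.var i ∈ Γ → ∀ x : W, (N.val i (Quotient.mk s x) ↔ M.val i x)
  min_le : ∀ (e : S) (a b : Quotient s),
    (∃ x y, Quotient.mk s x = a ∧ Quotient.mk s y = b ∧ M.rel e x y) → N.rel e a b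
  le_max : ∀ (e : S) (x y : W), N.rel e (Quotient.mk s x) (Quotient.mk s y) →
    ∀ φ, Formula.box e φ ∈ Γ → M.Sat x (Formula.box e φ) → M.Sat y φ

/-- A class of models admits definable filtration: for every finite subformula-closed `Γ`, each
model `M` of the class has a `Γ`-filtration in the class whose equivalence relation is induced
by a finite set of formulas. -/
def AdmitsDefinableFiltration (C : ∀ W : Type u, Set (Model S W)) : Prop :=
  ∀ Γ : Set (Formula S), Γ.Finite → SubClosed Γ →
    ∀ (W : Type u) (M : Model S W), M ∈ C W →
      ∃ Φ : Set (Formula S), Φ.Finite ∧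
        ∃ N : Model S (Quotient (M.equivOn Φ)),
          N ∈ C (Quotient (M.equivOn Φ)) ∧ IsFiltration M Γ (M.equivOn Φ) N

/-- `Mod(L)`: the class of all models of `L`. -/
def Mod (L : Set (Formula S)) : ∀ W : Type u, Set (Model S W) :=
  fun _ => {M | M.Models L}

/-! ### PDL-like expansions -/

/-- The alphabet `S` together with fresh symbols `e ∘ c`, `e ∪ c` and `e⁺` for `e, c` in `S`. -/
inductive Sharp (S : Type) : Type
  | base : S → Sharp S
  | comp : S → S → Sharp S
  | union : S → S → Sharp S
  | plus : S → Sharp S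

/-- The PDL-like axioms over the expanded alphabet. -/
inductive PDLAxiom : Formula (Sharp S) → Prop
  | union (e c : S) : PDLAxiom
      (iff (box (.union e c) (var 0)) (and (box (.base e) (var 0)) (box (.base c) (var 0))))
  | comp (e c : S) : PDLAxiom
      (iff (box (.comp e c) (var 0)) (box (.base e) (box (.base c) (var 0))))
  | plus_sub (e : S) : PDLAxiom
      (imp (box (.plus e) (var 0)) (box (.base e) (var 0)))
  | plus_step (e : S) : PDLAxiom
      (imp (box (.plus e) (var 0)) (box (.base e) (box (.plus e) (var 0))))
  | plus_ind (e : S) : PDLAxiom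
      (imp (box (.plus e) (imp (var 0) (box (.base e) (var 0))))
        (imp (box (.base e) (var 0)) (box (.plus e) (var 0))))

/-- The smallest normal logic over the expanded alphabet that contains `L` and the PDL-like
axioms. -/
def sharpLogic (L : Set (Formula S)) : Set (Formula (Sharp S)) :=
  smallestLogic (mapAlphabet Sharp.base '' L ∪ {φ | PDLAxiom φ})

/-- The iterated alphabet `S⁽ⁿ⁾`. -/
def IterAlphabet (S : Type) : ℕ → Type
  | 0 => S
  | n + 1 => Sharp (IterAlphabet S n)

/-- The iterated expansion `L⁽ⁿ⁾`. -/
def iterLogic (L : Set (Formula S)) : ∀ n : ℕ, Set (Formula (IterAlphabet S n))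
  | 0 => L
  | n + 1 => sharpLogic (iterLogic L n)

instance finite_sharp [Finite S] : Finite (Sharp S) := by
  let f : S ⊕ (S × S) ⊕ (S × S) ⊕ S → Sharp S
    | .inl e => .base e
    | .inr (.inl p) => .comp p.1 p.2
    | .inr (.inr (.inl p)) => .union p.1 p.2
    | .inr (.inr (.inr e)) => .plus e
  refine Finite.of_surjective f ?_
  rintro (e | ⟨e, c⟩ | ⟨e, c⟩ | e)
  exacts [⟨.inl e, rfl⟩, ⟨.inr (.inl (e, c)), rfl⟩, ⟨.inr (.inr (.inl (e, c))), rfl⟩,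
    ⟨.inr (.inr (.inr e)), rfl⟩]

instance finite_iterAlphabet [h : Finite S] (n : ℕ) : Finite (IterAlphabet S n) := by
  induction n with
  | zero => exact h
  | succ n ih => exact @finite_sharp _ ih

/-! ### Decidability

Formulas are coded by natural numbers relative to an injective numbering of the finite alphabet.
Any two such numberings differ by a finite bijection, so the notions below do not depend on the
numbering; they are stated for all of them. -/

/-- A set of formulas over a finite alphabet is decidable. -/
def DecidableSet [Finite S] (L : Set (Formula S)) : Prop :=
  ∀ ι : S → ℕ, Function.Injective ι → ComputablePred fun n : ℕ => ∃ φ ∈ L, code ι φ = n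

/-- A set of formulas over a finite alphabet is co-recursively enumerable: the set of formulas
outside of it is recursively enumerable. -/
def CoRESet [Finite S] (L : Set (Formula S)) : Prop :=
  ∀ ι : S → ℕ, Function.Injective ι → REPred fun n : ℕ => ∃ φ, φ ∉ L ∧ code ι φ = n

/-- The finite frame presented by `(m, l)`: its points are `0, …, m`, and `l` is the list of all
triples `(ι e, i, j)` with `i Rₑ j` (other entries of `l` are ignored). -/
def presentedFrame (ι : S → ℕ) (d : ℕ × List (ℕ × ℕ × ℕ)) : Frame S (Fin (d.1 + 1)) where
  nonempty := ⟨0⟩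
  rel e i j := (ι e, (i : ℕ), (j : ℕ)) ∈ d.2

/-- Over a finite alphabet, every frame on `Fin (m + 1)` has a finite presentation. -/
theorem exists_presentedFrame [Finite S] {ι : S → ℕ} (hι : Function.Injective ι) (m : ℕ)
    (F : Frame S (Fin (m + 1))) : ∃ l, presentedFrame ι (m, l) = F := by
  have hfin : {t : S × Fin (m + 1) × Fin (m + 1) | F.rel t.1 t.2.1 t.2.2}.Finite :=
    Set.toFinite _
  refine ⟨hfin.toFinset.toList.map fun t => (ι t.1, (t.2.1 : ℕ), (t.2.2 : ℕ)), ?_⟩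
  cases F with
  | mk hne rel =>
    unfold presentedFrame
    congr
    funext e i j
    simp only [List.mem_map, Finset.mem_toList, Set.Finite.mem_toFinset, Set.mem_ofPred_eq,
      Prod.mk.injEq, Prod.exists, eq_iff_iff]
    constructor
    · rintro ⟨e', i', j', h, h1, h2, h3⟩
      rwa [← hι h1, ← Fin.ext h2, ← Fin.ext h3]
    · exact fun h => ⟨e, i, j, h, rfl, rfl, rfl⟩

/-- The class of finite frames of `L` is decidable: there is an algorithm that decides, given a
finite presentation of a finite frame, whether the frame validates `L`. -/
def DecidableFiniteFrames [Finite S] (L : Set (Formula S)) : Prop :=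
  ∀ ι : S → ℕ, Function.Injective ι →
    ComputablePred fun d : ℕ × List (ℕ × ℕ × ℕ) => ∀ φ ∈ L, (presentedFrame ι d).Valid φ

end ModalLogic

/-!
A non-theorem of a logic `L` is refuted in the canonical model, which belongs to `Mod(L)`. If
`Mod(L)` admits definable filtration, it is thus refuted in a finite model of `L` all of whose
points are separated by formulas; hence every valuation in the underlying frame is definable, and
closure of `L` under substitution makes this frame validate `L`.

To filter a model `M` of `L♯` through `Γ`, let letters name the formulas of `Γ` and the formulas
`[e]φ` with `φ ∈ Γ`. Under this valuation the reduct of `M` is a model of `L`, again because `L`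
is closed under substitution. Take a definable filtration of it in `Mod(L)` and interpret the new
symbols in the quotient by composition, union and transitive closure. The only delicate point is
that `e⁺` in `M` relates two points only if the transitive closure relates their classes: the
classes reachable from a given one form a definable set, because the quotient is finite, so that
the induction axiom of `e⁺` applies to the defining formula.

As for computability, the complement of `L` is enumerated by searching through the pairs of a
formula and a finite `L`-frame that refutes it. If `L` is finitely axiomatizable, then its finite
frames are recognized by checking the axioms, and `L` itself is enumerated by searching through
derivations.
-/

namespace ModalLogic

open Formula

variable {S T : Type} {W : Type u}

/-! ### Truth and substitution -/

theorem Formula.subst_var (φ : Formula S) : φ.subst var = φ := by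
  induction φ with
  | bot | var => rfl
  | imp φ ψ ihφ ihψ => exact congrArg₂ imp ihφ ihψ
  | box e φ ih => exact congrArg (box e) ih

theorem Formula.subst_subst (σ τ : ℕ → Formula S) (φ : Formula S) :
    (φ.subst τ).subst σ = φ.subst fun i => (τ i).subst σ := by
  induction φ with
  | bot | var => rfl
  | imp φ ψ ihφ ihψ => exact congrArg₂ imp ihφ ihψ
  | box e φ ih => exact congrArg (box e) ih

namespace Model

theorem sat_imp (M : Model S W) (x : W) (φ ψ : Formula S) :
    M.Sat x (imp φ ψ) ↔ (M.Sat x φ → M.Sat x ψ) := Iff.rfl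

theorem sat_box (M : Model S W) (x : W) (e : S) (φ : Formula S) :
    M.Sat x (box e φ) ↔ ∀ y, M.rel e x y → M.Sat y φ := Iff.rfl

theorem sat_neg (M : Model S W) (x : W) (φ : Formula S) :
    M.Sat x (neg φ) ↔ ¬ M.Sat x φ := Iff.rfl

theorem sat_and (M : Model S W) (x : W) (φ ψ : Formula S) :
    M.Sat x (Formula.and φ ψ) ↔ M.Sat x φ ∧ M.Sat x ψ := by
  simp only [Formula.and, sat_neg, sat_imp]; tauto

theorem sat_iff (M : Model S W) (x : W) (φ ψ : Formula S) :
    M.Sat x (Formula.iff φ ψ) ↔ (M.Sat x φ ↔ M.Sat x ψ) := by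
  simp only [Formula.iff, sat_and, sat_imp]; tauto

/-- The model obtained from `M` by interpreting the letter `i` as the formula `σ i`. -/
def substVal (M : Model S W) (σ : ℕ → Formula S) : Model S W :=
  ⟨M.toFrame, fun i x => M.Sat x (σ i)⟩

theorem sat_subst (M : Model S W) (σ : ℕ → Formula S) (x : W) (φ : Formula S) :
    M.Sat x (φ.subst σ) ↔ (M.substVal σ).Sat x φ := by
  induction φ generalizing x with
  | bot | var => exact Iff.rfl
  | imp φ ψ ihφ ihψ => exact imp_congr (ihφ x) (ihψ x)
  | box e φ ih => exact forall_congr' fun y => imp_congr_right fun _ => ih y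

theorem Models.substVal {M : Model S W} {L : Set (Formula S)} (hM : M.Models L)
    (hL : IsNormalLogic L) (σ : ℕ → Formula S) : (M.substVal σ).Models L :=
  fun φ hφ x => (M.sat_subst σ x φ).1 (hM _ (hL.subst σ φ hφ) x)

theorem isNormalLogic_sat_subst (M : Model S W) :
    IsNormalLogic {φ | ∀ (σ : ℕ → Formula S) (x : W), M.Sat x (φ.subst σ)} where
  taut _ h σ x := h (fun ψ => M.Sat x (ψ.subst σ)) (fun h => h) fun _ _ => Iff.rfl
  axiomK _ _ _ h h' y hy := h y hy (h' y hy)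
  mp _ _ h h' σ x := h σ x (h' σ x)
  subst τ φ h σ x := subst_subst σ τ φ ▸ h _ x
  nec _ _ h σ _ y _ := h σ y

theorem models_smallestLogic {M : Model S W} {A : Set (Formula S)}
    (hM : ∀ φ ∈ A, ∀ (σ : ℕ → Formula S) (x : W), M.Sat x (φ.subst σ)) :
    M.Models (smallestLogic A) := fun φ hφ x => by
  simpa only [subst_var] using hφ _ M.isNormalLogic_sat_subst hM var x

end Model

theorem subset_smallestLogic (A : Set (Formula S)) : A ⊆ smallestLogic A :=
  fun _ hφ _ _ hA => hA hφ

/-- The reduct of a frame along a map of alphabets. -/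
def Frame.reduct (F : Frame T W) (f : S → T) : Frame S W := ⟨F.nonempty, fun e => F.rel (f e)⟩

/-- The reduct of a model along a map of alphabets. -/
def Model.reduct (M : Model T W) (f : S → T) : Model S W := ⟨M.toFrame.reduct f, M.val⟩

theorem Model.sat_mapAlphabet (M : Model T W) (f : S → T) (x : W) (φ : Formula S) :
    M.Sat x (φ.mapAlphabet f) ↔ (M.reduct f).Sat x φ := by
  induction φ generalizing x with
  | bot | var => exact Iff.rfl
  | imp φ ψ ihφ ihψ => exact imp_congr (ihφ x) (ihψ x)
  | box e φ ih => exact forall_congr' fun y => imp_congr_right fun _ => ih y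

theorem Frame.valid_mapAlphabet (F : Frame T W) (f : S → T) (φ : Formula S) :
    F.Valid (φ.mapAlphabet f) ↔ (F.reduct f).Valid φ :=
  forall_congr' fun V => forall_congr' fun x => (Model.mk F V).sat_mapAlphabet f x φ

theorem Frame.isNormalLogic_valid (F : Frame S W) : IsNormalLogic {φ | F.Valid φ} where
  taut _ h V x := h (fun ψ => (Model.mk F V).Sat x ψ) (fun h => h) fun _ _ => Iff.rfl
  axiomK _ _ _ h h' y hy := h y hy (h' y hy)
  mp _ _ h h' V x := h V x (h' V x)
  subst τ φ h V x := ((Model.mk F V).sat_subst τ x φ).2 (h _ x)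
  nec _ _ h V _ y _ := h V y

/-! ### Derivations and Lindenbaum's lemma -/

/-- The axioms of a Hilbert calculus for classical propositional logic. -/
def propAxioms (S : Type) : Set (Formula S) :=
  {imp (var 0) (imp (var 1) (var 0)),
    imp (imp (var 0) (imp (var 1) (var 2))) (imp (imp (var 0) (var 1)) (imp (var 0) (var 2))),
    imp bot (var 0),
    imp (imp (var 1) (var 0)) (imp (imp (imp (var 1) (var 2)) (var 0)) (var 0))}

/-- The substitution that replaces the letter `i` by the `i`-th entry of a list, and the letters
beyond its length by `⊥`. Since a formula has finitely many letters, these substitutions have the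
same instances as arbitrary ones. -/
def listSubst (l : List (Formula S)) (i : ℕ) : Formula S := l.getD i bot

/-- Sets of formulas that contain all instances of the propositional axioms and are closed under
modus ponens. -/
structure IsTheory (B : Set (Formula S)) : Prop where
  subst_mem : ∀ φ ∈ propAxioms S, ∀ σ : ℕ → Formula S, φ.subst σ ∈ B
  mp : ∀ φ ψ, imp φ ψ ∈ B → φ ∈ B → ψ ∈ B

/-- Boolean truth assignments. -/
def IsValuation (v : Formula S → Prop) : Prop :=
  ¬ v bot ∧ ∀ ψ χ, v (imp ψ χ) ↔ (v ψ → v χ)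

namespace IsTheory

variable {B : Set (Formula S)}

theorem weaken (hB : IsTheory B) (φ ψ : Formula S) : imp φ (imp ψ φ) ∈ B :=
  hB.subst_mem (imp (var 0) (imp (var 1) (var 0))) (by simp [propAxioms]) (listSubst [φ, ψ])

theorem distrib (hB : IsTheory B) (φ ψ χ : Formula S) :
    imp (imp φ (imp ψ χ)) (imp (imp φ ψ) (imp φ χ)) ∈ B :=
  hB.subst_mem
    (imp (imp (var 0) (imp (var 1) (var 2))) (imp (imp (var 0) (var 1)) (imp (var 0) (var 2))))
    (by simp [propAxioms]) (listSubst [φ, ψ, χ])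

theorem exfalso (hB : IsTheory B) (φ : Formula S) : imp bot φ ∈ B :=
  hB.subst_mem (imp bot (var 0)) (by simp [propAxioms]) (listSubst [φ])

theorem by_cases (hB : IsTheory B) (φ ψ χ : Formula S) :
    imp (imp ψ φ) (imp (imp (imp ψ χ) φ) φ) ∈ B :=
  hB.subst_mem (imp (imp (var 1) (var 0)) (imp (imp (imp (var 1) (var 2)) (var 0)) (var 0)))
    (by simp [propAxioms]) (listSubst [φ, ψ, χ])

theorem imp_mem (hB : IsTheory B) (φ : Formula S) {ψ : Formula S} (hψ : ψ ∈ B) : imp φ ψ ∈ B :=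
  hB.mp _ _ (hB.weaken ψ φ) hψ

theorem imp_self (hB : IsTheory B) (φ : Formula S) : imp φ φ ∈ B :=
  hB.mp _ _ (hB.mp _ _ (hB.distrib φ (imp φ φ) φ) (hB.weaken φ (imp φ φ))) (hB.weaken φ φ)

theorem adjoin (hB : IsTheory B) (φ : Formula S) : IsTheory {ψ | imp φ ψ ∈ B} where
  subst_mem ψ hψ σ := hB.imp_mem φ (hB.subst_mem ψ hψ σ)
  mp ψ χ hψχ hψ := hB.mp _ _ (hB.mp _ _ (hB.distrib φ ψ χ) hψχ) hψ

theorem isValuation_of_maximal {φ : Formula S}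
    (hB : Maximal (fun C : Set (Formula S) => IsTheory C ∧ φ ∉ C) B) :
    IsValuation (· ∈ B) := by
  obtain ⟨⟨hT, hφ⟩, hmax⟩ := hB
  have imp_of_notMem : ∀ ψ, ψ ∉ B → imp ψ φ ∈ B := fun ψ hψ => by
    by_contra hc
    exact hψ (hmax ⟨hT.adjoin ψ, hc⟩ (fun χ hχ => hT.imp_mem ψ hχ) (hT.imp_self ψ))
  refine ⟨fun h => hφ (hT.mp _ _ (hT.exfalso φ) h), fun ψ χ => ⟨hT.mp ψ χ, fun h => ?_⟩⟩
  by_contra hc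
  have hψ : ψ ∉ B := fun hψ => hc (hT.imp_mem ψ (h hψ))
  exact hφ (hT.mp _ _ (hT.mp _ _ (hT.by_cases φ ψ χ) (imp_of_notMem ψ hψ)) (imp_of_notMem _ hc))

theorem sUnion {c : Set (Set (Formula S))} (hc : ∀ C ∈ c, IsTheory C) (hchain : IsChain (· ⊆ ·) c)
    (hne : c.Nonempty) : IsTheory (⋃₀ c) where
  subst_mem φ hφ σ := let ⟨C, hC⟩ := hne; ⟨C, hC, (hc C hC).subst_mem φ hφ σ⟩
  mp := by
    rintro φ ψ ⟨C, hC, hφψ⟩ ⟨D, hD, hφ⟩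
    rcases hchain.total hC hD with hCD | hDC
    · exact ⟨D, hD, (hc D hD).mp φ ψ (hCD hφψ) hφ⟩
    · exact ⟨C, hC, (hc C hC).mp φ ψ hφψ (hDC hφ)⟩

theorem exists_valuation (hB : IsTheory B) {φ : Formula S} (hφ : φ ∉ B) :
    ∃ v : Formula S → Prop, IsValuation v ∧ (∀ ψ ∈ B, v ψ) ∧ ¬ v φ := by
  obtain ⟨C, hBC, hC⟩ := zorn_subset_nonempty {C : Set (Formula S) | IsTheory C ∧ φ ∉ C}
    (fun c hc hchain hne => ⟨⋃₀ c,
      ⟨sUnion (fun C hC => (hc hC).1) hchain hne, fun ⟨C, hC, hφC⟩ => (hc hC).2 hφC⟩,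
      fun _ => Set.subset_sUnion_of_mem⟩) B ⟨hB, hφ⟩
  exact ⟨(· ∈ C), isValuation_of_maximal hC, fun ψ hψ => hBC hψ, hC.prop.2⟩

end IsTheory

theorem isTautology_subst_of_mem_propAxioms {φ : Formula S} (hφ : φ ∈ propAxioms S)
    (σ : ℕ → Formula S) : IsTautology (φ.subst σ) := by
  intro v hbot himp
  rcases hφ with rfl | rfl | rfl | rfl <;> simp only [Formula.subst, himp] <;> tauto

theorem IsNormalLogic.isTheory {L : Set (Formula S)} (hL : IsNormalLogic L) : IsTheory L where
  subst_mem _ hφ σ := hL.taut _ (isTautology_subst_of_mem_propAxioms hφ σ)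
  mp := hL.mp

/-- The axioms of the least normal logic. -/
def normalAxioms (S : Type) : Set (Formula S) :=
  propAxioms S ∪ Set.range fun e =>
    imp (box e (imp (var 0) (var 1))) (imp (box e (var 0)) (box e (var 1)))

/-- Derivability from the substitution instances of `A` by modus ponens and necessitation. -/
inductive Derivable (A : Set (Formula S)) : Formula S → Prop
  | ax {φ : Formula S} (hφ : φ ∈ A) (σ : ℕ → Formula S) : Derivable A (φ.subst σ)
  | mp {φ ψ : Formula S} : Derivable A (imp φ ψ) → Derivable A φ → Derivable A ψ
  | nec {φ : Formula S} (e : S) : Derivable A φ → Derivable A (box e φ)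

theorem Derivable.of_mem {A : Set (Formula S)} {φ : Formula S} (hφ : φ ∈ A) : Derivable A φ :=
  subst_var φ ▸ .ax hφ var

theorem Derivable.subst {A : Set (Formula S)} {φ : Formula S} (hφ : Derivable A φ)
    (σ : ℕ → Formula S) : Derivable A (φ.subst σ) := by
  induction hφ with
  | ax hφ τ => exact subst_subst σ τ _ ▸ .ax hφ _
  | mp _ _ ihφψ ihφ => exact ihφψ.mp ihφ
  | nec e _ ih => exact ih.nec e

theorem isNormalLogic_derivable (A : Set (Formula S)) :
    IsNormalLogic {φ | Derivable (normalAxioms S ∪ A) φ} where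
  taut φ hφ := by
    have hT : IsTheory {φ | Derivable (normalAxioms S ∪ A) φ} :=
      ⟨fun φ hφ σ => .ax (.inl (.inl hφ)) σ, fun _ _ => .mp⟩
    by_contra hc
    obtain ⟨v, ⟨hbot, himp⟩, -, hv⟩ := hT.exists_valuation hc
    exact hv (hφ v hbot himp)
  axiomK e := .of_mem (.inl (.inr ⟨e, rfl⟩))
  mp _ _ := .mp
  subst σ _ hφ := hφ.subst σ
  nec e _ := .nec e

theorem mem_smallestLogic_iff {A : Set (Formula S)} {φ : Formula S} :
    φ ∈ smallestLogic A ↔ Derivable (normalAxioms S ∪ A) φ := by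
  refine ⟨fun h => h _ (isNormalLogic_derivable A) fun _ hψ => .of_mem (.inr hψ),
    fun h L hL hA => ?_⟩
  induction h with
  | ax hφ σ =>
    rcases hφ with (hφ | ⟨e, rfl⟩) | hφ
    · exact hL.isTheory.subst_mem _ hφ σ
    · exact hL.subst σ _ (hL.axiomK e)
    · exact hL.subst σ _ (hA hφ)
  | mp _ _ ihφψ ihφ => exact hL.mp _ _ ihφψ ihφ
  | nec e _ ih => exact hL.nec e _ ih

theorem IsNormalLogic.box_mp {L : Set (Formula S)} (hL : IsNormalLogic L) (e : S)
    (φ ψ : Formula S) : imp (box e (imp φ ψ)) (imp (box e φ) (box e ψ)) ∈ L :=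
  hL.subst (listSubst [φ, ψ]) _ (hL.axiomK e)

/-! ### The canonical model -/

/-- The points of the canonical model of `L`: the truth assignments that make all of `L` true, a
form of the maximal `L`-consistent sets. They are lifted to the universe of the models. -/
def CanonicalPoint (L : Set (Formula S)) : Type u :=
  ULift.{u} {v : Formula S → Prop // IsValuation v ∧ ∀ φ ∈ L, v φ}

/-- The canonical model of `L`. -/
def canonicalModel (L : Set (Formula S)) (h : Nonempty (CanonicalPoint.{u} L)) :
    Model S (CanonicalPoint.{u} L) where
  nonempty := h
  rel e x y := ∀ φ, x.down.1 (box e φ) → y.down.1 φ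
  val i x := x.down.1 (var i)

namespace IsNormalLogic

variable {L : Set (Formula S)}

theorem isTheory_box (hL : IsNormalLogic L) (x : CanonicalPoint.{u} L) (e : S) :
    IsTheory {φ | x.down.1 (box e φ)} where
  subst_mem φ hφ σ := x.down.2.2 _ (hL.nec e _ (hL.isTheory.subst_mem φ hφ σ))
  mp φ ψ hφψ hφ := by
    have hK := x.down.2.2 _ (hL.box_mp e φ ψ)
    rw [x.down.2.1.2, x.down.2.1.2] at hK
    exact hK hφψ hφ

theorem exists_canonical_successor (hL : IsNormalLogic L) {x : CanonicalPoint.{u} L} {e : S}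
    {φ : Formula S} (hφ : ¬ x.down.1 (box e φ)) :
    ∃ y : CanonicalPoint.{u} L, (∀ ψ, x.down.1 (box e ψ) → y.down.1 ψ) ∧ ¬ y.down.1 φ := by
  obtain ⟨v, hv, hvx, hvφ⟩ := (hL.isTheory_box x e).exists_valuation hφ
  exact ⟨⟨v, hv, fun ψ hψ => hvx ψ (x.down.2.2 _ (hL.nec e ψ hψ))⟩, hvx, hvφ⟩

theorem canonicalModel_sat (hL : IsNormalLogic L) (h : Nonempty (CanonicalPoint.{u} L))
    (x : CanonicalPoint.{u} L) (φ : Formula S) :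
    (canonicalModel L h).Sat x φ ↔ x.down.1 φ := by
  induction φ generalizing x with
  | bot => exact ⟨False.elim, x.down.2.1.1⟩
  | var i => exact Iff.rfl
  | imp φ ψ ihφ ihψ => rw [x.down.2.1.2, ← ihφ, ← ihψ]; rfl
  | box e φ ih =>
    refine ⟨fun hx => ?_, fun hx y hy => (ih y).2 (hy φ hx)⟩
    by_contra hc
    obtain ⟨y, hxy, hy⟩ := hL.exists_canonical_successor hc
    exact hy ((ih y).1 (hx y hxy))

theorem exists_model (hL : IsNormalLogic L) {φ : Formula S} (hφ : φ ∉ L) :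
    ∃ (W : Type u) (M : Model S W) (x : W), M.Models L ∧ ¬ M.Sat x φ := by
  obtain ⟨v, hv, hvL, hvφ⟩ := hL.isTheory.exists_valuation hφ
  let x : CanonicalPoint.{u} L := ⟨v, hv, hvL⟩
  exact ⟨_, canonicalModel L ⟨x⟩, x,
    fun ψ hψ y => (hL.canonicalModel_sat _ y ψ).2 (y.down.2.2 ψ hψ),
    fun h => hvφ ((hL.canonicalModel_sat _ x φ).1 h)⟩

end IsNormalLogic

/-! ### Definable sets of points -/

namespace Model

theorem exists_sat_iff_forall_mem (M : Model S W) (l : List (Formula S)) :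
    ∃ θ : Formula S, ∀ x, M.Sat x θ ↔ ∀ φ ∈ l, M.Sat x φ := by
  induction l with
  | nil => exact ⟨neg bot, fun x => by simp [sat_neg, Sat]⟩
  | cons φ l ih =>
    obtain ⟨θ, hθ⟩ := ih
    exact ⟨Formula.and φ θ, fun x => by simp only [sat_and, hθ, List.forall_mem_cons]⟩

theorem exists_sat_iff_forall_of_finite (M : Model S W) {ι : Type*} [Finite ι]
    (f : ι → Formula S) : ∃ θ : Formula S, ∀ x, M.Sat x θ ↔ ∀ i, M.Sat x (f i) := by
  have := Fintype.ofFinite ι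
  obtain ⟨θ, hθ⟩ := M.exists_sat_iff_forall_mem (Finset.univ.toList.map f)
  exact ⟨θ, fun x => by simp [hθ]⟩

theorem exists_sat_iff_forall [Finite W] (M : Model S W) {ι : Type*} (f : ι → Formula S) :
    ∃ θ : Formula S, ∀ x, M.Sat x θ ↔ ∀ i, M.Sat x (f i) := by
  let truth : ι → Set W := fun i => {x | M.Sat x (f i)}
  choose i hi using fun s : Set.range truth => s.2
  obtain ⟨θ, hθ⟩ := M.exists_sat_iff_forall_of_finite fun s => f (i s)
  refine ⟨θ, fun x => (hθ x).trans ⟨fun h j => ?_, fun h s => h _⟩⟩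
  have hx : x ∈ truth (i ⟨truth j, j, rfl⟩) := h _
  rwa [hi] at hx

/-- Every union of classes of `s` is defined by a formula. -/
def IsDefinable (M : Model S W) (s : Setoid W) : Prop :=
  ∀ P : Quotient s → Prop, ∃ δ : Formula S, ∀ x, M.Sat x δ ↔ P (Quotient.mk s x)

theorem exists_separating {M : Model S W} {Φ : Set (Formula S)} {a b : Quotient (M.equivOn Φ)}
    (hab : a ≠ b) : ∃ θ : Formula S, (∀ x, Quotient.mk _ x = a → M.Sat x θ) ∧
      ∀ x, Quotient.mk _ x = b → ¬ M.Sat x θ := by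
  induction a, b using Quotient.inductionOn₂ with | _ y z
  obtain ⟨φ, hφ, h⟩ : ∃ φ ∈ Φ, ¬ (M.Sat y φ ↔ M.Sat z φ) := by
    by_contra! hc
    exact hab (Quotient.sound hc)
  have sat_congr : ∀ {x w}, Quotient.mk (M.equivOn Φ) x = Quotient.mk _ w →
    (M.Sat x φ ↔ M.Sat w φ) := fun hxw => Quotient.exact hxw φ hφ
  by_cases hy : M.Sat y φ
  · exact ⟨φ, fun x hx => (sat_congr hx).2 hy,
      fun x hx hc => h (iff_of_true hy ((sat_congr hx).1 hc))⟩
  · exact ⟨neg φ, fun x hx hc => hy ((sat_congr hx).1 hc),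
      fun x hx hc => h (iff_of_false hy fun hz => hc ((sat_congr hx).2 hz))⟩

theorem exists_sat_iff_mk_eq (M : Model S W) (Φ : Set (Formula S))
    [Finite (Quotient (M.equivOn Φ))] (a : Quotient (M.equivOn Φ)) :
    ∃ χ : Formula S, ∀ x, M.Sat x χ ↔ Quotient.mk _ x = a := by
  choose θ hθa hθb using fun b : {b // a ≠ b} => exists_separating b.2
  obtain ⟨χ, hχ⟩ := M.exists_sat_iff_forall_of_finite θ
  refine ⟨χ, fun x => (hχ x).trans ⟨fun h => ?_, fun hx b => hθa b x hx⟩⟩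
  by_contra hne
  exact hθb ⟨_, Ne.symm hne⟩ x rfl (h _)

theorem isDefinable_equivOn (M : Model S W) (Φ : Set (Formula S))
    [Finite (Quotient (M.equivOn Φ))] : M.IsDefinable (M.equivOn Φ) := by
  intro P
  choose χ hχ using M.exists_sat_iff_mk_eq Φ
  obtain ⟨δ, hδ⟩ := M.exists_sat_iff_forall_of_finite fun a : {a // ¬ P a} => neg (χ a)
  refine ⟨δ, fun x => ?_⟩
  simp only [hδ, sat_neg, hχ, Subtype.forall]
  exact ⟨fun h => by_contra fun hc => h _ hc rfl, fun h a ha hx => ha (hx ▸ h)⟩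

theorem Models.valid_of_forall_definable {M : Model S W} {L : Set (Formula S)}
    (hM : M.Models L) (hL : IsNormalLogic L)
    (hdef : ∀ P : W → Prop, ∃ δ : Formula S, ∀ x, M.Sat x δ ↔ P x) {φ : Formula S}
    (hφ : φ ∈ L) : M.toFrame.Valid φ := by
  intro V x
  choose δ hδ using fun i => hdef (V i)
  have hV : M.substVal δ = ⟨M.toFrame, V⟩ :=
    congrArg (Model.mk M.toFrame) (funext fun i => funext fun x => propext (hδ i x))
  exact hV ▸ hM.substVal hL δ φ hφ x

end Model

/-! ### Filtrations and the finite model property -/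

theorem mem_sub_self (φ : Formula S) : φ ∈ sub φ := by
  cases φ <;> simp [sub]

theorem finite_sub (φ : Formula S) : (sub φ).Finite := by
  induction φ with
  | bot | var => exact Set.finite_singleton _
  | imp φ ψ ihφ ihψ => exact ((Set.finite_singleton _).union ihφ).union ihψ
  | box e φ ih => exact (Set.finite_singleton _).union ih

theorem subClosed_sub (φ : Formula S) : SubClosed (sub φ) := by
  induction φ with
  | bot | var => rintro ψ rfl; exact subset_rfl
  | imp φ ψ ihφ ihψ =>
    rintro χ ((rfl | hχ) | hχ)
    · exact subset_rfl
    · exact (ihφ χ hχ).trans fun _ h => .inl (.inr h)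
    · exact (ihψ χ hχ).trans fun _ h => .inr h
  | box e φ ih =>
    rintro χ (rfl | hχ)
    · exact subset_rfl
    · exact (ih χ hχ).trans fun _ h => .inr h

namespace SubClosed

variable {Γ : Set (Formula S)} {φ ψ : Formula S}

theorem of_imp_left (hΓ : SubClosed Γ) (h : imp φ ψ ∈ Γ) : φ ∈ Γ :=
  hΓ _ h (.inl (.inr (mem_sub_self φ)))

theorem of_imp_right (hΓ : SubClosed Γ) (h : imp φ ψ ∈ Γ) : ψ ∈ Γ :=
  hΓ _ h (.inr (mem_sub_self ψ))

theorem of_box (hΓ : SubClosed Γ) {e : S} (h : box e φ ∈ Γ) : φ ∈ Γ :=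
  hΓ _ h (.inr (mem_sub_self φ))

end SubClosed

theorem IsFiltration.sat_iff {M : Model S W} {Γ : Set (Formula S)} {s : Setoid W}
    {N : Model S (Quotient s)} (hN : IsFiltration M Γ s N) (hΓ : SubClosed Γ) {φ : Formula S}
    (hφ : φ ∈ Γ) (x : W) : N.Sat (Quotient.mk s x) φ ↔ M.Sat x φ := by
  induction φ generalizing x with
  | bot => exact Iff.rfl
  | var i => exact hN.val_iff i hφ x
  | imp φ ψ ihφ ihψ =>
    exact imp_congr (ihφ (hΓ.of_imp_left hφ) x) (ihψ (hΓ.of_imp_right hφ) x)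
  | box e φ ih =>
    have ih := ih (hΓ.of_box hφ)
    refine ⟨fun hx y hxy => (ih y).1 (hx _ (hN.min_le e _ _ ⟨x, y, rfl, rfl, hxy⟩)),
      fun hx b => ?_⟩
    induction b using Quotient.inductionOn with | _ y
    exact fun hxy => (ih y).2 (hN.le_max e x y hxy φ hφ hx)

namespace Model

/-- The quotient of a model by modal equivalence, with the least filtration relations. -/
def collapse (M : Model S W) : Model S (Quotient (M.equivOn Set.univ)) where
  nonempty := M.nonempty.map (Quotient.mk _)
  rel e a b := ∃ x y, Quotient.mk _ x = a ∧ Quotient.mk _ y = b ∧ M.rel e x y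
  val i a := ∃ x, Quotient.mk _ x = a ∧ M.val i x

theorem isFiltration_collapse [Finite W] (M : Model S W) :
    IsFiltration M Set.univ (M.equivOn Set.univ) M.collapse where
  finite_index := inferInstance
  respects _ _ h := h
  val_iff i _ x :=
    ⟨fun ⟨_, hy, h⟩ => (Quotient.exact hy (var i) trivial).1 h, fun h => ⟨x, rfl, h⟩⟩
  min_le _ _ _ h := h
  le_max e _ _ := fun ⟨_, y', hx', hy', hxy'⟩ φ _ hx =>
    (Quotient.exact hy' φ trivial).1 ((Quotient.exact hx' (box e φ) trivial).2 hx y' hxy')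

theorem sat_collapse [Finite W] (M : Model S W) (x : W) (φ : Formula S) :
    M.collapse.Sat (Quotient.mk _ x) φ ↔ M.Sat x φ :=
  M.isFiltration_collapse.sat_iff (fun _ _ => Set.subset_univ _) trivial x

theorem Models.valid_collapse [Finite W] {M : Model S W} {L : Set (Formula S)}
    (hM : M.Models L) (hL : IsNormalLogic L) {φ : Formula S} (hφ : φ ∈ L) :
    M.collapse.Valid φ := by
  have hcollapse : M.collapse.Models L := fun ψ hψ a => by
    induction a using Quotient.inductionOn with | _ x
    exact (M.sat_collapse x ψ).2 (hM ψ hψ x)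
  refine hcollapse.valid_of_forall_definable hL (fun P => ?_) hφ
  obtain ⟨δ, hδ⟩ := M.isDefinable_equivOn Set.univ P
  exact ⟨δ, Quotient.ind fun x => (M.sat_collapse x δ).trans (hδ x)⟩

end Model

theorem HasFMP.kripkeComplete {L : Set (Formula S)} (h : HasFMP.{u} L) : KripkeComplete.{u} L :=
  h.imp fun _ h => h.2

namespace AdmitsDefinableFiltration

variable {L : Set (Formula S)}

theorem exists_finite_frame (h : AdmitsDefinableFiltration (Mod.{u} L)) (hL : IsNormalLogic L)
    {φ : Formula S} (hφ : φ ∉ L) :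
    ∃ (W : Type u) (F : Frame S W), Finite W ∧ (∀ ψ ∈ L, F.Valid ψ) ∧ ¬ F.Valid φ := by
  obtain ⟨W, M, x, hM, hx⟩ := hL.exists_model.{u} hφ
  obtain ⟨Φ, -, N, hN : N.Models L, hf⟩ := h (sub φ) (finite_sub φ) (subClosed_sub φ) W M hM
  have := hf.finite_index
  refine ⟨_, N.collapse.toFrame, inferInstance, fun ψ => hN.valid_collapse hL, fun hc => hx ?_⟩
  rw [← hf.sat_iff (subClosed_sub φ) (mem_sub_self φ) x, ← N.sat_collapse]
  exact hc N.collapse.val _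

theorem hasFMP (h : AdmitsDefinableFiltration (Mod.{u} L)) (hL : IsNormalLogic L) :
    HasFMP.{u} L := by
  refine ⟨fun W => {F | Finite W ∧ ∀ ψ ∈ L, F.Valid ψ}, fun W ⟨F, hF⟩ => hF.1,
    Set.Subset.antisymm (fun φ hφ W F hF => hF.2 φ hφ) fun φ hφ => ?_⟩
  by_contra hc
  obtain ⟨W, F, hW, hF, hFφ⟩ := h.exists_finite_frame hL hc
  exact hFφ (hφ W F ⟨hW, hF⟩)

end AdmitsDefinableFiltration

/-! ### Standard models of the expanded alphabet -/

/-- The expansion of a frame in which the new symbols denote composition, union and transitive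
closure. -/
def Frame.sharp (F : Frame S W) : Frame (Sharp S) W where
  nonempty := F.nonempty
  rel
    | .base e => F.rel e
    | .comp e c => fun x y => ∃ z, F.rel e x z ∧ F.rel c z y
    | .union e c => fun x y => F.rel e x y ∨ F.rel c x y
    | .plus e => Relation.TransGen (F.rel e)

/-- The expansion of a model in which the new symbols denote composition, union and transitive
closure. -/
def Model.sharp (N : Model S W) : Model (Sharp S) W := ⟨N.toFrame.sharp, N.val⟩

theorem Frame.forall_sharp_union_iff (F : Frame S W) {e c : S} {x : W} {P : W → Prop} :
    (∀ y, F.sharp.rel (.union e c) x y → P y) ↔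
      (∀ y, F.rel e x y → P y) ∧ ∀ y, F.rel c x y → P y :=
  ⟨fun h => ⟨fun y hy => h y (.inl hy), fun y hy => h y (.inr hy)⟩,
    fun h y hy => hy.elim (h.1 y) (h.2 y)⟩

theorem Frame.forall_sharp_comp_iff (F : Frame S W) {e c : S} {x : W} {P : W → Prop} :
    (∀ y, F.sharp.rel (.comp e c) x y → P y) ↔ ∀ z, F.rel e x z → ∀ y, F.rel c z y → P y :=
  ⟨fun h z hz y hy => h y ⟨z, hz, hy⟩, fun h y ⟨z, hz, hy⟩ => h z hz y hy⟩

theorem Frame.sharp_valid (F : Frame S W) {φ : Formula (Sharp S)} (hφ : PDLAxiom φ) :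
    F.sharp.Valid φ := by
  intro V x
  cases hφ with
  | union e c =>
    rw [Model.sat_iff, Model.sat_and]
    exact F.forall_sharp_union_iff
  | comp e c =>
    rw [Model.sat_iff]
    exact F.forall_sharp_comp_iff
  | plus_sub e => exact fun h y hy => h y (.single hy)
  | plus_step e => exact fun h y hy z hz => h z (.head hy hz)
  | plus_ind e =>
    intro hstep hbase y hy
    induction hy with
    | single hy => exact hbase _ hy
    | tail hy hz ih => exact hstep _ hy ih _ hz

theorem Model.forall_sat_iterate_box_iff (M : Model S W) (e : S) (x : W) (φ : Formula S) :
    (∀ k, M.Sat x ((box e)^[k + 1] φ)) ↔ ∀ y, Relation.TransGen (M.rel e) x y → M.Sat y φ := by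
  simp only [Function.iterate_succ_apply']
  refine ⟨fun hx y hy => ?_, fun hx k => ?_⟩
  · induction hy using Relation.TransGen.head_induction_on with
    | single hxy => exact hx 0 _ hxy
    | head hxz _ ih =>
      exact ih fun k => by simpa only [Function.iterate_succ_apply'] using hx (k + 1) _ hxz
  · induction k generalizing x with
    | zero => exact fun y hy => hx y (.single hy)
    | succ k ih =>
      rw [Function.iterate_succ_apply']
      exact fun y hy => ih y fun z hz => hx z (.head hy hz)

theorem Model.exists_sat_sharp_iff [Finite W] (N : Model S W) (φ : Formula (Sharp S)) :
    ∃ ψ : Formula S, ∀ x, N.sharp.Sat x φ ↔ N.Sat x ψ := by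
  induction φ with
  | bot => exact ⟨bot, fun _ => Iff.rfl⟩
  | var i => exact ⟨var i, fun _ => Iff.rfl⟩
  | imp φ₁ φ₂ ih₁ ih₂ =>
    obtain ⟨ψ₁, h₁⟩ := ih₁
    obtain ⟨ψ₂, h₂⟩ := ih₂
    exact ⟨imp ψ₁ ψ₂, fun x => imp_congr (h₁ x) (h₂ x)⟩
  | box e φ ih =>
    obtain ⟨ψ, hψ⟩ := ih
    simp only [sat_box, hψ]
    cases e with
    | base e => exact ⟨box e ψ, fun x => Iff.rfl⟩
    | union e c =>
      exact ⟨Formula.and (box e ψ) (box c ψ),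
        fun x => N.toFrame.forall_sharp_union_iff.trans (N.sat_and x (box e ψ) (box c ψ)).symm⟩
    | comp e c => exact ⟨box e (box c ψ), fun x => N.toFrame.forall_sharp_comp_iff⟩
    | plus e =>
      obtain ⟨θ, hθ⟩ := N.exists_sat_iff_forall fun k : ℕ => (box e)^[k + 1] ψ
      exact ⟨θ, fun x => ((hθ x).trans (N.forall_sat_iterate_box_iff e x ψ)).symm⟩

/-! ### Letters as names of formulas -/

/-- The formula over the expanded alphabet that `φ` stands for when the letter `i` is a name of the
formula `τ i`. -/
def expand (τ : ℕ → Formula (Sharp S)) (φ : Formula S) : Formula (Sharp S) :=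
  (φ.mapAlphabet .base).subst τ

/-- The model over the original alphabet in which the letter `i` is a name of the formula `τ i`. -/
def Model.naming (M : Model (Sharp S) W) (τ : ℕ → Formula (Sharp S)) : Model S W :=
  (M.substVal τ).reduct .base

theorem Model.sat_expand (M : Model (Sharp S) W) (τ : ℕ → Formula (Sharp S)) (x : W)
    (φ : Formula S) : M.Sat x (expand τ φ) ↔ (M.naming τ).Sat x φ :=
  (M.sat_subst τ x _).trans ((M.substVal τ).sat_mapAlphabet .base x φ)

theorem Model.equivOn_naming (M : Model (Sharp S) W) (τ : ℕ → Formula (Sharp S))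
    (Φ : Set (Formula S)) : (M.naming τ).equivOn Φ = M.equivOn (expand τ '' Φ) := by
  ext x y
  refine Iff.trans ?_ Set.forall_mem_image.symm
  simp only [sat_expand]
  rfl

theorem Model.Models.naming {M : Model (Sharp S) W} {L : Set (Formula S)}
    (hM : M.Models (sharpLogic L)) (τ : ℕ → Formula (Sharp S)) : (M.naming τ).Models L :=
  fun φ hφ x => (M.sat_expand τ x φ).1 (hM _
    ((isNormalLogic_smallestLogic _).subst τ _ (subset_smallestLogic _ (.inl ⟨φ, hφ, rfl⟩))) x)

theorem Model.Models.sharp [Finite W] {N : Model S W} {L : Set (Formula S)} (hN : N.Models L)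
    (hL : IsNormalLogic L) : N.sharp.Models (sharpLogic L) := by
  refine models_smallestLogic ?_
  rintro φ (⟨ψ, hψ, rfl⟩ | hφ) τ x
  · choose ρ hρ using fun i => N.exists_sat_sharp_iff (τ i)
    have hnaming : N.sharp.naming τ = N.substVal ρ :=
      congrArg (Model.mk N.toFrame) (funext fun i => funext fun x => propext (hρ i x))
    exact (N.sharp.sat_expand τ x ψ).2 (hnaming ▸ hN.substVal hL ρ ψ hψ x)
  · exact (N.sharp.sat_subst τ x φ).2 (N.toFrame.sharp_valid hφ _ x)

/-! ### Models of the expanded logic -/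

namespace Model.Models

variable {M : Model (Sharp S) W} {L : Set (Formula S)} (hM : M.Models (sharpLogic L)) (x : W)
  (e c : S) (φ : Formula (Sharp S))

include hM

theorem sat_pdlAxiom {ψ : Formula (Sharp S)} (hψ : PDLAxiom ψ) : M.Sat x (ψ.subst fun _ => φ) :=
  hM _ ((isNormalLogic_smallestLogic _).subst _ _ (subset_smallestLogic _ (.inr hψ))) x

theorem sat_box_union_iff : M.Sat x (box (.union e c) φ) ↔
    M.Sat x (box (.base e) φ) ∧ M.Sat x (box (.base c) φ) :=
  ((M.sat_iff x _ _).1 (hM.sat_pdlAxiom x φ (.union e c))).trans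
    (M.sat_and x (box (.base e) φ) (box (.base c) φ))

theorem sat_box_comp_iff : M.Sat x (box (.comp e c) φ) ↔
    M.Sat x (box (.base e) (box (.base c) φ)) :=
  (M.sat_iff x _ _).1 (hM.sat_pdlAxiom x φ (.comp e c))

theorem sat_box_base_of_plus : M.Sat x (box (.plus e) φ) → M.Sat x (box (.base e) φ) :=
  hM.sat_pdlAxiom x φ (.plus_sub e)

theorem sat_box_base_box_plus_of_plus :
    M.Sat x (box (.plus e) φ) → M.Sat x (box (.base e) (box (.plus e) φ)) :=
  hM.sat_pdlAxiom x φ (.plus_step e)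

theorem sat_box_plus_of_induction : M.Sat x (box (.plus e) (imp φ (box (.base e) φ))) →
    M.Sat x (box (.base e) φ) → M.Sat x (box (.plus e) φ) :=
  hM.sat_pdlAxiom x φ (.plus_ind e)

end Model.Models

/-! ### Filtrations of models of the expanded logic -/

/-- The set `Γ` together with the formulas `[e]φ` for `φ ∈ Γ` and `e` in the original alphabet: the
formulas that the filtration over the original alphabet has to respect. -/
def baseClosure (Γ : Set (Formula (Sharp S))) : Set (Formula (Sharp S)) :=
  Γ ∪ Set.image2 (fun e φ => box (.base e) φ) Set.univ Γ

namespace Model.Models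

variable {M : Model (Sharp S) W} {L : Set (Formula S)} {s : Setoid W}

theorem sharp_rel_mk (hM : M.Models (sharpLogic L)) (hs : M.IsDefinable s)
    (F : Frame S (Quotient s))
    (hF : ∀ e x y, M.rel (.base e) x y → F.rel e (Quotient.mk s x) (Quotient.mk s y))
    (e : Sharp S) (x y : W) (hxy : M.rel e x y) :
    F.sharp.rel e (Quotient.mk s x) (Quotient.mk s y) := by
  -- `δ` says that the class of a point is `F.sharp.rel e`-accessible from the class of `x`, so the
  -- axioms for `e` can be applied to it at `x`.
  obtain ⟨δ, hδ⟩ := hs fun b => F.sharp.rel e (Quotient.mk s x) b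
  suffices hx : M.Sat x (box e δ) from (hδ y).1 (hx y hxy)
  cases e with
  | base e => exact fun z hz => (hδ z).2 (hF e x z hz)
  | union e c =>
    exact (hM.sat_box_union_iff x e c δ).2 ⟨fun z hz => (hδ z).2 (.inl (hF _ _ _ hz)),
      fun z hz => (hδ z).2 (.inr (hF _ _ _ hz))⟩
  | comp e c =>
    exact (hM.sat_box_comp_iff x e c δ).2
      fun z hz w hw => (hδ w).2 ⟨_, hF _ _ _ hz, hF _ _ _ hw⟩
  | plus e =>
    refine hM.sat_box_plus_of_induction x e δ (fun z _ hz w hw => ?_) fun z hz => ?_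
    · exact (hδ w).2 (.tail ((hδ z).1 hz) (hF _ _ _ hw))
    · exact (hδ z).2 (.single (hF _ _ _ hz))

theorem sat_of_sharp_rel_plus (hM : M.Models (sharpLogic L)) {F : Frame S (Quotient s)} {e : S}
    {φ : Formula (Sharp S)} (hφ : ∀ x y, F.rel e (Quotient.mk s x) (Quotient.mk s y) →
      M.Sat x (box (.base e) φ) → M.Sat y φ)
    (hplus : ∀ x y, F.rel e (Quotient.mk s x) (Quotient.mk s y) →
      M.Sat x (box (.base e) (box (.plus e) φ)) → M.Sat y (box (.plus e) φ))
    {x y : W} (hxy : Relation.TransGen (F.rel e) (Quotient.mk s x) (Quotient.mk s y))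
    (hx : M.Sat x (box (.plus e) φ)) : M.Sat y φ := by
  generalize ha : Quotient.mk s x = a at hxy
  induction hxy using Relation.TransGen.head_induction_on generalizing x with
  | single hab =>
    subst ha
    exact hφ x y hab (hM.sat_box_base_of_plus x e φ hx)
  | @head a c hac _ ih =>
    subst ha
    induction c using Quotient.inductionOn with | _ z
    exact ih (hplus x z hac (hM.sat_box_base_box_plus_of_plus x e φ hx)) rfl

theorem sat_of_sharp_rel (hM : M.Models (sharpLogic L)) {Γ : Set (Formula (Sharp S))}
    (hΓ : SubClosed Γ) {F : Frame S (Quotient s)}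
    (hF : ∀ e, ∀ φ ∈ baseClosure Γ, ∀ x y, F.rel e (Quotient.mk s x) (Quotient.mk s y) →
      M.Sat x (box (.base e) φ) → M.Sat y φ)
    (e : Sharp S) (x y : W) (hxy : F.sharp.rel e (Quotient.mk s x) (Quotient.mk s y))
    (φ : Formula (Sharp S)) (hφ : box e φ ∈ Γ) (hx : M.Sat x (box e φ)) : M.Sat y φ := by
  have hφΓ := hΓ.of_box hφ
  cases e with
  | base e => exact hF e φ (.inl hφΓ) x y hxy hx
  | union e c =>
    obtain ⟨he, hc⟩ := (hM.sat_box_union_iff x e c φ).1 hx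
    exact hxy.elim (fun h => hF e φ (.inl hφΓ) x y h he) fun h => hF c φ (.inl hφΓ) x y h hc
  | comp e c =>
    obtain ⟨b, hxz, hzy⟩ := hxy
    induction b using Quotient.inductionOn with | _ z
    exact hF c φ (.inl hφΓ) z y hzy
      (hF e _ (.inr ⟨c, trivial, φ, hφΓ, rfl⟩) x z hxz ((hM.sat_box_comp_iff x e c φ).1 hx))
  | plus e =>
    exact hM.sat_of_sharp_rel_plus (hF e φ (.inl hφΓ)) (hF e _ (.inl hφ)) hxy hx

end Model.Models

/-- The formulas over the original alphabet that make a filtration respect the formulas in `Δ` and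
their boxes, where the letter `q φ` is a name of the formula `φ`. -/
def nameSet (q : Formula (Sharp S) → ℕ) (Δ : Set (Formula (Sharp S))) : Set (Formula S) :=
  (fun φ => var (q φ)) '' Δ ∪ Set.image2 (fun e φ => box e (var (q φ))) Set.univ Δ

theorem finite_baseClosure [Finite S] {Γ : Set (Formula (Sharp S))} (hΓ : Γ.Finite) :
    (baseClosure Γ).Finite :=
  hΓ.union (Set.finite_univ.image2 _ hΓ)

theorem finite_nameSet [Finite S] (q : Formula (Sharp S) → ℕ) {Δ : Set (Formula (Sharp S))}
    (hΔ : Δ.Finite) : (nameSet q Δ).Finite :=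
  (hΔ.image _).union (Set.finite_univ.image2 _ hΔ)

theorem subClosed_nameSet (q : Formula (Sharp S) → ℕ) (Δ : Set (Formula (Sharp S))) :
    SubClosed (nameSet q Δ) := by
  rintro φ (⟨ψ, hψ, rfl⟩ | ⟨e, -, ψ, hψ, rfl⟩)
  · rintro _ rfl
    exact .inl ⟨ψ, hψ, rfl⟩
  · rintro _ (rfl | rfl)
    · exact .inr ⟨e, trivial, ψ, hψ, rfl⟩
    · exact .inl ⟨ψ, hψ, rfl⟩

theorem IsFiltration.sharp {M : Model (Sharp S) W} {L : Set (Formula S)}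
    (hM : M.Models (sharpLogic L)) {Γ : Set (Formula (Sharp S))} (hΓ : SubClosed Γ)
    {τ : ℕ → Formula (Sharp S)} {q : Formula (Sharp S) → ℕ} (hq : Function.RightInverse q τ)
    {s : Setoid W} (hs : M.IsDefinable s) {N : Model S (Quotient s)}
    (hN : IsFiltration (M.naming τ) (nameSet q (baseClosure Γ)) s N) :
    IsFiltration M Γ s (N.substVal fun i => var (q (var i))).sharp := by
  have sat_name : ∀ φ x, (M.naming τ).Sat x (var (q φ)) ↔ M.Sat x φ := fun φ x =>
    iff_of_eq (congrArg (M.Sat x) (hq φ))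
  have name_mem : ∀ φ ∈ Γ, var (q φ) ∈ nameSet q (baseClosure Γ) := fun φ hφ =>
    .inl ⟨φ, .inl hφ, rfl⟩
  refine ⟨hN.finite_index, fun x y hxy φ hφ => ?_, fun i hi x => ?_, ?_, ?_⟩
  · simpa only [sat_name] using hN.respects x y hxy _ (name_mem φ hφ)
  · exact (hN.val_iff _ (name_mem _ hi) x).trans (sat_name _ x)
  · rintro e _ _ ⟨x, y, rfl, rfl, hxy⟩
    exact hM.sharp_rel_mk hs N.toFrame
      (fun e x y hxy => hN.min_le e _ _ ⟨x, y, rfl, rfl, hxy⟩) e x y hxy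
  · refine hM.sat_of_sharp_rel hΓ fun e φ hφ x y hxy hx => (sat_name φ y).1 ?_
    exact hN.le_max e x y hxy _ (.inr ⟨e, trivial, φ, hφ, rfl⟩)
      fun z hz => (sat_name φ z).2 (hx z hz)

instance countable_formula [Countable S] : Countable (Formula S) :=
  let ⟨_, hι⟩ := exists_injective_nat S
  (code_injective hι).countable

theorem AdmitsDefinableFiltration.sharp [Finite S] {L : Set (Formula S)} (hL : IsNormalLogic L)
    (h : AdmitsDefinableFiltration (Mod.{u} L)) :
    AdmitsDefinableFiltration (Mod.{u} (sharpLogic L)) := by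
  intro Γ hΓfin hΓ W M (hM : M.Models (sharpLogic L))
  have : Nonempty (Formula (Sharp S)) := ⟨bot⟩
  obtain ⟨τ, hτ⟩ := exists_surjective_nat (Formula (Sharp S))
  let q := Function.surjInv hτ
  obtain ⟨Ψ, hΨ, hfiltration⟩ := h (nameSet q (baseClosure Γ))
    (finite_nameSet q (finite_baseClosure hΓfin)) (subClosed_nameSet q _) W (M.naming τ)
    (hM.naming τ)
  rw [M.equivOn_naming τ Ψ] at hfiltration
  obtain ⟨N, hN : N.Models L, hf⟩ := hfiltration
  have := hf.finite_index
  exact ⟨expand τ '' Ψ, hΨ.image _, _, (hN.substVal hL _).sharp hL,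
    hf.sharp hM hΓ (Function.rightInverse_surjInv hτ) (M.isDefinable_equivOn _)⟩

/-! ### Primitive recursion over formulas -/

/-- Algebras of the signature of modal formulas over `S`. They are the recursion schemes for
functions on formulas, since formulas form the free such algebra on the letters. -/
structure FormulaAlgebra (S : Type) (σ : Type*) where
  bot : σ
  var : ℕ → σ
  imp : σ → σ → σ
  box : S → σ → σ

/-- The unique homomorphism from formulas to `A`. -/
def Formula.fold {σ : Type*} (A : FormulaAlgebra S σ) : Formula S → σ
  | bot => A.bot
  | var i => A.var i
  | imp φ ψ => A.imp (fold A φ) (fold A ψ)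
  | box e φ => A.box e (fold A φ)

namespace FormulaAlgebra

variable {α σ : Type*}

/-- The algebra of formulas, whose operations are the constructors. -/
def free (S : Type) : FormulaAlgebra S (Formula S) where
  bot := .bot
  var := .var
  imp := .imp
  box := .box

/-- The algebra of Gödel numbers. -/
def numbers (S : Type) [Encodable S] : FormulaAlgebra S ℕ where
  bot := Nat.pair 0 0
  var i := Nat.pair 1 i
  imp m n := Nat.pair 2 (Nat.pair m n)
  box e n := Nat.pair 3 (Nat.pair (Encodable.encode e) n)

theorem fold_free (φ : Formula S) : φ.fold (free S) = φ := by
  induction φ with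
  | bot | var _ => rfl
  | imp φ ψ ihφ ihψ => rw [Formula.fold, ihφ, ihψ, free]
  | box e φ ih => rw [Formula.fold, ih, free]

theorem fold_numbers [Encodable S] (φ : Formula S) :
    φ.fold (numbers S) = code Encodable.encode φ := by
  induction φ with
  | bot | var _ => rfl
  | imp φ ψ ihφ ihψ => rw [Formula.fold, ihφ, ihψ, numbers, code]
  | box e φ ih => rw [Formula.fold, ih, numbers, code]

section FoldCode

variable [Encodable S] (A : FormulaAlgebra S σ)

/-- The value of `A` at the formula with Gödel number `n`, computed from the values `r m` at the
smaller numbers `m`; it is `none` if `n` is not the number of a formula. -/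
def foldStep (n : ℕ) (r : ℕ → Option σ) : Option σ :=
  if n.unpair.1 = 0 then (if n.unpair.2 = 0 then some A.bot else none)
  else if n.unpair.1 = 1 then some (A.var n.unpair.2)
  else if n.unpair.1 = 2 then
    (r n.unpair.2.unpair.1).bind fun s => (r n.unpair.2.unpair.2).map (A.imp s)
  else if n.unpair.1 = 3 then
    (Encodable.decode n.unpair.2.unpair.1).bind fun e => (r n.unpair.2.unpair.2).map (A.box e)
  else none

/-- Course-of-values recursion along `FormulaAlgebra.foldStep`. -/
def foldCode (n : ℕ) : Option σ :=
  A.foldStep n fun m => if m < n then foldCode m else none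

theorem foldCode_code (φ : Formula S) :
    A.foldCode (code Encodable.encode φ) = some (φ.fold A) := by
  have lt_pair {k m n : ℕ} (hk : 0 < k) (h : m ≤ n) : m < Nat.pair k n :=
    (h.trans_lt (Nat.lt_add_of_pos_left hk)).trans_le (Nat.add_le_pair k n)
  induction φ with
  | bot | var _ => simp [foldCode, foldStep, code, Formula.fold]
  | imp φ ψ ihφ ihψ =>
    rw [foldCode]
    simp [foldStep, code, ihφ, ihψ, Formula.fold, lt_pair, Nat.left_le_pair, Nat.right_le_pair]
  | box e φ ih =>
    rw [foldCode]
    simp [foldStep, code, ih, Formula.fold, lt_pair, Nat.right_le_pair]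

theorem foldCode_eq_map_free (n : ℕ) :
    A.foldCode n = ((free S).foldCode n).map (Formula.fold A) := by
  induction n using Nat.strong_induction_on with
  | _ n ih =>
    have h (m : ℕ) : (if m < n then A.foldCode m else none) =
        (if m < n then (free S).foldCode m else none).map (Formula.fold A) := by
      split_ifs with hm
      · exact ih m hm
      · rfl
    rw [foldCode, foldCode]
    simp only [h, foldStep]
    split_ifs <;> simp [Option.map_bind, Function.comp_def, Option.bind_map, free, Formula.fold]

end FoldCode

/-- A family of algebras whose operations are primitive recursive, uniformly in the parameter. -/
structure IsPrimrec [Primcodable α] [Primcodable S] [Primcodable σ]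
    (A : α → FormulaAlgebra S σ) : Prop where
  bot : Primrec fun a => (A a).bot
  var : Primrec fun q : α × ℕ => (A q.1).var q.2
  imp : Primrec fun q : α × σ × σ => (A q.1).imp q.2.1 q.2.2
  box : Primrec fun q : α × S × σ => (A q.1).box q.2.1 q.2.2

variable [Primcodable α] [Primcodable S] [Primcodable σ] {A : α → FormulaAlgebra S σ}

theorem IsPrimrec.foldStep (hA : IsPrimrec A) {β : Type*} [Primcodable β] {a : β → α} {n : β → ℕ}
    {r : β → ℕ → Option σ} (ha : Primrec a) (hn : Primrec n) (hr : Primrec₂ r) :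
    Primrec fun b => (A (a b)).foldStep (n b) (r b) := by
  have hk : Primrec fun b => (n b).unpair.1 := Primrec.fst.comp (Primrec.unpair.comp hn)
  have hm : Primrec fun b => (n b).unpair.2 := Primrec.snd.comp (Primrec.unpair.comp hn)
  have hm₁ : Primrec fun b => (n b).unpair.2.unpair.1 :=
    Primrec.fst.comp (Primrec.unpair.comp hm)
  have hm₂ : Primrec fun b => (n b).unpair.2.unpair.2 :=
    Primrec.snd.comp (Primrec.unpair.comp hm)
  have is (j : ℕ) : PrimrecPred fun b => (n b).unpair.1 = j :=
    Primrec.eq.comp hk (Primrec.const j)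
  refine .ite (is 0) (.ite (Primrec.eq.comp hm (.const 0))
    (Primrec.option_some.comp (hA.bot.comp ha)) (.const none)) <|
    .ite (is 1) (Primrec.option_some.comp (hA.var.comp (ha.pair hm))) <|
    .ite (is 2) ?imp <| .ite (is 3) ?box (.const none)
  case imp =>
    exact Primrec.option_bind (hr.comp .id hm₁) <|
      Primrec.option_map (hr.comp .fst (hm₂.comp .fst)) <|
      hA.imp.comp ((ha.comp (Primrec.fst.comp .fst)).pair ((Primrec.snd.comp .fst).pair .snd))
  case box =>
    exact Primrec.option_bind (Primrec.decode.comp hm₁) <|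
      Primrec.option_map (hr.comp .fst (hm₂.comp .fst)) <|
      hA.box.comp ((ha.comp (Primrec.fst.comp .fst)).pair ((Primrec.snd.comp .fst).pair .snd))

theorem IsPrimrec.foldCode (hA : IsPrimrec A) : Primrec₂ fun a n => (A a).foldCode n := by
  have lookup : Primrec₂ fun (q : α × List (Option σ)) m => q.2.getD m none :=
    (Primrec.list_getD none).comp (Primrec.snd.comp .fst) .snd
  have step : Primrec₂ fun a l =>
      some ((A a).foldStep (List.length l) fun m => l.getD m none) :=
    Primrec.option_some.comp
      (hA.foldStep .fst (Primrec.list_length.comp .snd) lookup)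
  refine Primrec.nat_strong_rec _ step fun a n => ?_
  rw [FormulaAlgebra.foldCode, List.length_map, List.length_range]
  congr 2
  funext m
  by_cases hm : m < n <;> simp [hm]

theorem isPrimrec_numbers : IsPrimrec fun _ : α => numbers S where
  bot := .const _
  var := Primrec₂.natPair.comp (.const 1) .snd
  imp := Primrec₂.natPair.comp (.const 2)
    (Primrec₂.natPair.comp (Primrec.fst.comp .snd) (Primrec.snd.comp .snd))
  box := Primrec₂.natPair.comp (.const 3)
    (Primrec₂.natPair.comp (Primrec.encode.comp (Primrec.fst.comp .snd))
      (Primrec.snd.comp .snd))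

end FormulaAlgebra

open FormulaAlgebra (IsPrimrec free numbers)

instance encodableFormula [Encodable S] : Encodable (Formula S) where
  encode := code Encodable.encode
  decode := (free S).foldCode
  encodek φ := by rw [FormulaAlgebra.foldCode_code, FormulaAlgebra.fold_free]

theorem subst_eq_fold (σ : ℕ → Formula S) (φ : Formula S) :
    φ.subst σ = φ.fold { free S with var := σ } := by
  induction φ with
  | bot | var _ => rfl
  | imp φ ψ ihφ ihψ => rw [Formula.subst, Formula.fold, ihφ, ihψ, free]
  | box e φ ih => rw [Formula.subst, Formula.fold, ih, free]

section Primcodable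

variable [Primcodable S]

instance primcodableFormula : Primcodable (Formula S) where
  prim := by
    have h : Primrec fun n => (numbers S).foldCode n :=
      FormulaAlgebra.isPrimrec_numbers.foldCode.comp (Primrec.const ()) .id
    refine Primrec.nat_iff.1 ((Primrec.encode.comp h).of_eq fun n => ?_)
    rw [FormulaAlgebra.foldCode_eq_map_free]
    change _ = Encodable.encode ((free S).foldCode n)
    cases (free S).foldCode n with
    | none => rfl
    | some φ => exact congrArg (Encodable.encode ∘ some) (FormulaAlgebra.fold_numbers φ)

theorem primrec_imp : Primrec₂ (imp : Formula S → Formula S → Formula S) :=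
  Primrec.encode_iff.1 <| Primrec₂.natPair.comp (.const 2) <|
    Primrec₂.natPair.comp (Primrec.encode.comp .fst) (Primrec.encode.comp .snd)

theorem primrec_box : Primrec₂ (box : S → Formula S → Formula S) :=
  Primrec.encode_iff.1 <| Primrec₂.natPair.comp (.const 3) <|
    Primrec₂.natPair.comp (Primrec.encode.comp .fst) (Primrec.encode.comp .snd)

variable {α σ : Type*} [Primcodable α] [Primcodable σ]

theorem FormulaAlgebra.IsPrimrec.fold {A : α → FormulaAlgebra S σ} (hA : IsPrimrec A) :
    Primrec₂ fun (a : α) (φ : Formula S) => φ.fold (A a) :=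
  Primrec.option_some_iff.1 <|
    (hA.foldCode.comp .fst (Primrec.encode.comp .snd)).of_eq fun q =>
      FormulaAlgebra.foldCode_code (A q.1) q.2

theorem primrec_subst_listSubst :
    Primrec₂ fun (l : List (Formula S)) (φ : Formula S) => φ.subst (listSubst l) := by
  have hA : IsPrimrec fun l : List (Formula S) => { free S with var := listSubst l } :=
    { bot := .const _
      var := (Primrec.list_getD bot).comp .fst .snd
      imp := primrec_imp.comp (Primrec.fst.comp .snd) (Primrec.snd.comp .snd)
      box := primrec_box.comp (Primrec.fst.comp .snd) (Primrec.snd.comp .snd) }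
  exact hA.fold.of_eq fun l φ => (subst_eq_fold _ φ).symm

end Primcodable

/-! ### Primitive recursive and recursively enumerable predicates -/

section Predicates

variable {α β : Type*} [Primcodable α] [Primcodable β]

theorem rePred_exists {p : α → β → Prop} (hp : ComputablePred fun q : α × β => p q.1 q.2) :
    REPred fun a => ∃ b, p a b := by
  obtain ⟨f, hf, hpf⟩ := ComputablePred.computable_iff.1 hp
  have hpf (a : α) (b : β) : p a b ↔ f (a, b) := iff_of_eq (congrFun hpf (a, b))
  have hsearch : Computable₂ fun (a : α) (n : ℕ) =>
      (Encodable.decode (α := β) n).bind fun b => bif f (a, b) then some () else none :=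
    .option_bind (Computable.decode.comp .snd) <|
      .cond (hf.comp ((Computable.fst.comp .fst).pair .snd)) (.const _) (.const _)
  refine (Partrec.rfindOpt hsearch).dom_re.of_eq fun a => Nat.rfindOpt_dom.trans ?_
  constructor
  · rintro ⟨n, _, hn⟩
    obtain ⟨b, -, hb⟩ := Option.bind_eq_some_iff.1 hn
    refine ⟨b, (hpf a b).2 ?_⟩
    cases hab : f (a, b) with
    | true => rfl
    | false => simp [hab] at hb
  · rintro ⟨b, hb⟩
    exact ⟨Encodable.encode b, (), by simp [(hpf a b).1 hb]⟩

theorem computablePred_exists_encode_eq {p : α → Prop} (hp : ComputablePred p) :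
    ComputablePred fun n => ∃ a, p a ∧ Encodable.encode a = n := by
  obtain ⟨f, hf, rfl⟩ := ComputablePred.computable_iff.1 hp
  have hcode : Computable fun n => ((Encodable.decode₂ α n).map f).getD false :=
    .option_getD (.option_map Primrec.decode₂.to_comp (hf.comp .snd).to₂) (.const false)
  refine ComputablePred.computable_iff.2 ⟨_, hcode, funext fun n => propext ⟨?_, fun h => ?_⟩⟩
  · rintro ⟨a, ha, rfl⟩
    simp [ha]
  · cases hn : Encodable.decode₂ α n with
    | none => simp [hn] at h
    | some a => exact ⟨a, by simpa [hn] using h, Encodable.decode₂_eq_some.1 hn⟩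

theorem computablePred_and {p q : α → Prop} (hp : ComputablePred p) (hq : ComputablePred q) :
    ComputablePred fun a => p a ∧ q a := by
  obtain ⟨_, hp⟩ := hp
  obtain ⟨_, hq⟩ := hq
  exact ⟨inferInstance, (Primrec.and.to_comp.comp hp hq).of_eq fun a => by simp⟩

theorem computablePred_comp {p : β → Prop} (hp : ComputablePred p) {f : α → β}
    (hf : Computable f) : ComputablePred fun a => p (f a) := by
  obtain ⟨_, hp⟩ := hp
  exact ⟨inferInstance, hp.comp hf⟩

theorem rePred_comp {p : β → Prop} (hp : REPred p) {f : α → β} (hf : Computable f) :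
    REPred fun a => p (f a) :=
  Partrec.comp hp hf

theorem primrecPred_imp {p q : α → Prop} (hp : PrimrecPred p) (hq : PrimrecPred q) :
    PrimrecPred fun a => p a → q a :=
  (hp.not.or hq).of_eq fun _ => imp_iff_not_or.symm

theorem primrecPred_forall_mem {p : α → β → Prop} {l : α → List β}
    (hp : PrimrecPred fun q : α × β => p q.1 q.2) (hl : Primrec l) :
    PrimrecPred fun a => ∀ b ∈ l a, p a b :=
  (PrimrecRel.forall_mem_list (R := fun b a => p a b) (hp.comp (Primrec.snd.pair .fst))).comp
    hl .id

theorem primrecPred_exists_mem {p : α → β → Prop} {l : α → List β}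
    (hp : PrimrecPred fun q : α × β => p q.1 q.2) (hl : Primrec l) :
    PrimrecPred fun a => ∃ b ∈ l a, p a b :=
  (PrimrecRel.exists_mem_list (R := fun b a => p a b) (hp.comp (Primrec.snd.pair .fst))).comp
    hl .id

theorem primrecPred_mem {f : α → β} {l : α → List β} (hf : Primrec f) (hl : Primrec l) :
    PrimrecPred fun a => f a ∈ l a :=
  (primrecPred_exists_mem (p := fun a b => b = f a) (Primrec.eq.comp .snd (hf.comp .fst)) hl).of_eq
    fun _ => exists_eq_right

theorem primrec_filter {p : α → β → Prop} [∀ a, DecidablePred (p a)] {l : α → List β}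
    (hp : PrimrecPred fun q : α × β => p q.1 q.2) (hl : Primrec l) :
    Primrec fun a => (l a).filter (p a ·) :=
  (PrimrecRel.listFilter (R := fun b a => p a b) (hp.comp (Primrec.snd.pair .fst))).comp hl .id

theorem primrec_sublists' : Primrec (List.sublists' : List α → List (List α)) := by
  have hstep : Primrec₂ fun (_ : List α) (q : α × List (List α)) => q.2 ++ q.2.map (q.1 :: ·) :=
    Primrec.list_append.comp (Primrec.snd.comp .snd) <|
      Primrec.list_map (Primrec.snd.comp .snd) <|
        Primrec.list_cons.comp (Primrec.fst.comp (Primrec.snd.comp .fst)) .snd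
  refine (Primrec.list_foldr Primrec.id (Primrec.const [[]]) hstep).of_eq fun l => ?_
  induction l with
  | nil => rfl
  | cons a l ih => rw [List.sublists'_cons, ← ih]; rfl

theorem exists_primcodable_encode_eq [Finite S] {ι : S → ℕ} (hι : Function.Injective ι) :
    ∃ _ : Primcodable S, Encodable.encode = ι := by
  have hrange : PrimrecPred (· ∈ Set.range ι) :=
    (primrecPred_mem Primrec.id (Primrec.const (Set.finite_range ι).toFinset.toList)).of_eq
      fun n => by simp
  classical
  let : Primcodable (Set.range ι) := Primcodable.subtype hrange
  exact ⟨Primcodable.ofEquiv _ (Equiv.ofInjective ι hι), rfl⟩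

end Predicates

/-! ### Validity in finitely presented frames -/

/-- A bound for the letters that occur in a formula: they are all among `p₀, …, pₖ₋₁`, where `k` is
the value. -/
def varBound : Formula S → ℕ :=
  Formula.fold { bot := 0, var := Nat.succ, imp := max, box := fun _ n => n }

theorem subst_congr_of_lt_varBound {σ τ : ℕ → Formula S} (φ : Formula S)
    (h : ∀ i < varBound φ, σ i = τ i) : φ.subst σ = φ.subst τ := by
  induction φ with
  | bot => rfl
  | var i => exact h i (Nat.lt_succ_self i)
  | imp φ ψ ihφ ihψ =>
    rw [Formula.subst, Formula.subst, ihφ fun i hi => h i (lt_max_of_lt_left hi),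
      ihψ fun i hi => h i (lt_max_of_lt_right hi)]
  | box e φ ih => rw [Formula.subst, Formula.subst, ih h]

theorem subst_listSubst_map_range (σ : ℕ → Formula S) (φ : Formula S) :
    φ.subst (listSubst ((List.range (varBound φ)).map σ)) = φ.subst σ :=
  subst_congr_of_lt_varBound φ fun i hi => by simp [listSubst, hi]

theorem primrec_varBound [Primcodable S] : Primrec (varBound : Formula S → ℕ) := by
  have h : IsPrimrec fun _ : Unit =>
      ({ bot := 0, var := Nat.succ, imp := max, box := fun _ n => n } : FormulaAlgebra S ℕ) :=
    { bot := .const 0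
      var := Primrec.succ.comp .snd
      imp := Primrec.nat_max.comp (Primrec.fst.comp .snd) (Primrec.snd.comp .snd)
      box := Primrec.snd.comp .snd }
  exact h.fold.comp (.const ()) .id

/-- The encoding of finite frames by `presentedFrame`. -/
abbrev FramePresentation := ℕ × List (ℕ × ℕ × ℕ)

/-- The encoding of finite models: a presented frame with the list of the pairs `(i, x)` such that
the letter `pᵢ` is true at the point `x`. -/
abbrev ModelPresentation := FramePresentation × List (ℕ × ℕ)

/-- The model encoded by a presentation, relative to a numbering of the alphabet. -/
def presentedModel (ι : S → ℕ) (d : ModelPresentation) : Model S (Fin (d.1.1 + 1)) :=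
  ⟨presentedFrame ι d.1, fun i x => (i, (x : ℕ)) ∈ d.2⟩

/-- The points of a presented frame to which the relation numbered `k` relates the point `x`. -/
def successors (d : FramePresentation) (k x : ℕ) : List ℕ :=
  (List.range (d.1 + 1)).filter fun y => (k, x, y) ∈ d.2

/-- The complex algebra of a presented model, where sets of points are encoded by lists. -/
def truthAlgebra (ι : S → ℕ) (d : ModelPresentation) :
    FormulaAlgebra S (List ℕ) where
  bot := []
  var i := (List.range (d.1.1 + 1)).filter fun x => (i, x) ∈ d.2
  imp a b := (List.range (d.1.1 + 1)).filter fun x => x ∈ a → x ∈ b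
  box e a := (List.range (d.1.1 + 1)).filter fun x => ∀ y ∈ successors d.1 (ι e) x, y ∈ a

theorem mem_fold_truthAlgebra (ι : S → ℕ) (d : ModelPresentation) (φ : Formula S)
    (x : Fin (d.1.1 + 1)) :
    (x : ℕ) ∈ φ.fold (truthAlgebra ι d) ↔ (presentedModel ι d).Sat x φ := by
  induction φ generalizing x with
  | bot => exact iff_of_false List.not_mem_nil id
  | var i => simp [Formula.fold, truthAlgebra, Model.Sat, presentedModel, x.is_le]
  | imp φ ψ ihφ ihψ =>
    rw [Model.sat_imp, ← ihφ, ← ihψ]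
    simp [Formula.fold, truthAlgebra, x.is_le, imp_iff_not_or]
  | box e φ ih =>
    simp only [Model.sat_box, ← ih]
    simp [Formula.fold, truthAlgebra, successors, x.is_le, presentedModel, presentedFrame,
      Fin.forall_iff]

/-- The presentations of all valuations of the letters `p₀, …, pₖ₋₁` in a frame with points
`0, …, m`. -/
def valuations (k m : ℕ) : List (List (ℕ × ℕ)) :=
  ((List.range k).flatMap fun i => (List.range (m + 1)).map fun x => (i, x)).sublists'

theorem sat_iff_of_lt_varBound (F : Frame S W) {V V' : ℕ → W → Prop} (φ : Formula S)
    (h : ∀ i < varBound φ, ∀ x, V i x ↔ V' i x) (x : W) :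
    (Model.mk F V).Sat x φ ↔ (Model.mk F V').Sat x φ := by
  induction φ generalizing x with
  | bot => exact Iff.rfl
  | var i => exact h i (Nat.lt_succ_self i) x
  | imp φ ψ ihφ ihψ =>
    exact imp_congr (ihφ (fun i hi => h i (lt_max_of_lt_left hi)) x)
      (ihψ (fun i hi => h i (lt_max_of_lt_right hi)) x)
  | box e φ ih => exact forall_congr' fun y => imp_congr_right fun _ => ih h y

theorem exists_mem_valuations_sat_iff (ι : S → ℕ) (d : FramePresentation)
    (V : ℕ → Fin (d.1 + 1) → Prop) (φ : Formula S) :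
    ∃ v ∈ valuations (varBound φ) d.1, ∀ x,
      (Model.mk (presentedFrame ι d) V).Sat x φ ↔ (presentedModel ι (d, v)).Sat x φ := by
  classical
  refine ⟨_, List.mem_sublists'.2 (List.filter_sublist
    (p := fun q => decide (∃ h : q.2 < d.1 + 1, V q.1 ⟨q.2, h⟩))), ?_⟩
  refine sat_iff_of_lt_varBound _ φ fun i hi x => ?_
  simp [hi, x.is_le]

theorem presentedFrame_valid_iff (ι : S → ℕ) (d : FramePresentation) (φ : Formula S) :
    (presentedFrame ι d).Valid φ ↔ ∀ v ∈ valuations (varBound φ) d.1,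
      ∀ x ∈ List.range (d.1 + 1), x ∈ φ.fold (truthAlgebra ι (d, v)) := by
  refine ⟨fun h v _ x hx => ?_, fun h V x => ?_⟩
  · exact (mem_fold_truthAlgebra ι (d, v) φ ⟨x, List.mem_range.1 hx⟩).2 (h _ _)
  · obtain ⟨v, hv, hVv⟩ := exists_mem_valuations_sat_iff ι d V φ
    exact (hVv x).2 ((mem_fold_truthAlgebra ι (d, v) φ x).1 (h v hv x (List.mem_range.2 x.2)))

section PresentedFrames

variable [Primcodable S]

theorem primrec_points {α : Type*} [Primcodable α] {m : α → ℕ} (hm : Primrec m) :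
    Primrec fun a => List.range (m a + 1) :=
  Primrec.list_range.comp (Primrec.succ.comp hm)

theorem primrec_successors :
    Primrec fun q : FramePresentation × ℕ × ℕ => successors q.1 q.2.1 q.2.2 :=
  primrec_filter (primrecPred_mem
    ((Primrec.fst.comp (Primrec.snd.comp .fst)).pair
      ((Primrec.snd.comp (Primrec.snd.comp .fst)).pair .snd))
    (Primrec.snd.comp (Primrec.fst.comp .fst))) (primrec_points (Primrec.fst.comp .fst))

theorem isPrimrec_truthAlgebra : IsPrimrec (truthAlgebra (Encodable.encode : S → ℕ)) where
  bot := .const []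
  var := primrec_filter (primrecPred_mem ((Primrec.snd.comp .fst).pair .snd)
    (Primrec.snd.comp (Primrec.fst.comp .fst))) (primrec_points (Primrec.fst.comp
      (Primrec.fst.comp .fst)))
  imp := by
    refine primrec_filter (primrecPred_imp (primrecPred_mem .snd ?_) (primrecPred_mem .snd ?_))
      (primrec_points (Primrec.fst.comp (Primrec.fst.comp .fst)))
    · exact Primrec.fst.comp (Primrec.snd.comp .fst)
    · exact Primrec.snd.comp (Primrec.snd.comp .fst)
  box := by
    refine primrec_filter (p := fun (q : ModelPresentation × S × List ℕ) x =>
        ∀ y ∈ successors q.1.1 (Encodable.encode q.2.1) x, y ∈ q.2.2)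
      (primrecPred_forall_mem
        (p := fun (r : (ModelPresentation × S × List ℕ) × ℕ) y => y ∈ r.1.2.2)
        (primrecPred_mem .snd (Primrec.snd.comp (Primrec.snd.comp (Primrec.fst.comp .fst)))) ?_)
      (primrec_points (Primrec.fst.comp (Primrec.fst.comp .fst)))
    exact primrec_successors.comp ((Primrec.fst.comp (Primrec.fst.comp .fst)).pair
      ((Primrec.encode.comp (Primrec.fst.comp (Primrec.snd.comp .fst))).pair .snd))

theorem primrec_valuations : Primrec₂ valuations :=
  primrec_sublists'.comp <| Primrec.list_flatMap (Primrec.list_range.comp .fst) <|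
    Primrec.list_map (Primrec.list_range.comp (Primrec.succ.comp (Primrec.snd.comp .fst))) <|
      Primrec.pair (Primrec.snd.comp .fst) .snd

theorem primrecPred_presentedFrame_valid :
    PrimrecPred fun q : FramePresentation × Formula S =>
      (presentedFrame Encodable.encode q.1).Valid q.2 := by
  have htruth : Primrec fun r : (FramePresentation × Formula S) × List (ℕ × ℕ) =>
      r.1.2.fold (truthAlgebra Encodable.encode (r.1.1, r.2)) :=
    isPrimrec_truthAlgebra.fold.comp ((Primrec.fst.comp .fst).pair .snd) (Primrec.snd.comp .fst)
  refine PrimrecPred.of_eq (primrecPred_forall_mem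
    (p := fun q v => ∀ x ∈ List.range (q.1.1 + 1),
      x ∈ q.2.fold (truthAlgebra Encodable.encode (q.1, v)))
    (primrecPred_forall_mem
      (p := fun (r : (FramePresentation × Formula S) × List (ℕ × ℕ)) x =>
        x ∈ r.1.2.fold (truthAlgebra Encodable.encode (r.1.1, r.2)))
      (primrecPred_mem .snd (htruth.comp .fst)) ?_) ?_)
    fun q => (presentedFrame_valid_iff Encodable.encode q.1 q.2).symm
  · exact primrec_points (Primrec.fst.comp (Primrec.fst.comp .fst))
  · exact primrec_valuations.comp (primrec_varBound.comp .snd) (Primrec.fst.comp .fst)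

end PresentedFrames

/-! ### Enumerating derivations -/

/-- The correctness of one step of a derivation from the axioms `A`: the formula `s.1` is an
instance of an axiom or follows from formulas in `Γ` by a rule. The second component of `s` lists
the values of the substitution on `p₀, p₁, …` in the first case; the others ignore it. -/
def Justified (A Γ : List (Formula S)) (s : Formula S × List (Formula S)) : Prop :=
  (∃ φ ∈ A, φ.subst (listSubst s.2) = s.1) ∨ (∃ φ ∈ Γ, imp φ s.1 ∈ Γ) ∨
    ∃ φ ∈ Γ, ∃ e, box e φ = s.1

open Classical in
/-- The formulas derived in the sequence `p` of steps, which is read from right to left. Incorrect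
steps are skipped, so that every sequence of steps is a derivation. -/
noncomputable def derivedFormulas (A : List (Formula S)) (p : List (Formula S × List (Formula S))) :
    List (Formula S) :=
  p.foldr (fun s Γ => if Justified A Γ s then s.1 :: Γ else Γ) []

theorem mem_derivedFormulas_cons (A : List (Formula S)) (s : Formula S × List (Formula S))
    (p : List (Formula S × List (Formula S))) {φ : Formula S} :
    φ ∈ derivedFormulas A (s :: p) ↔
      Justified A (derivedFormulas A p) s ∧ φ = s.1 ∨ φ ∈ derivedFormulas A p := by
  rw [derivedFormulas, List.foldr_cons, ← derivedFormulas]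
  split_ifs with h <;> simp [h]

theorem Justified.mono {A Γ Δ : List (Formula S)} {s : Formula S × List (Formula S)}
    (h : Justified A Γ s) (hΓΔ : Γ ⊆ Δ) : Justified A Δ s := by
  obtain h | ⟨φ, hφ, himp⟩ | ⟨φ, hφ, hbox⟩ := h
  exacts [.inl h, .inr (.inl ⟨φ, hΓΔ hφ, hΓΔ himp⟩), .inr (.inr ⟨φ, hΓΔ hφ, hbox⟩)]

theorem Justified.derivable {A Γ : List (Formula S)} {s : Formula S × List (Formula S)}
    (h : Justified A Γ s) (hΓ : ∀ φ ∈ Γ, Derivable {φ | φ ∈ A} φ) :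
    Derivable {φ | φ ∈ A} s.1 := by
  obtain ⟨φ, hφ, hs⟩ | ⟨φ, hφ, himp⟩ | ⟨φ, hφ, e, hs⟩ := h
  exacts [hs ▸ .ax hφ _, (hΓ _ himp).mp (hΓ φ hφ), hs ▸ (hΓ φ hφ).nec e]

theorem derivedFormulas_subset_append_right (A : List (Formula S))
    (p q : List (Formula S × List (Formula S))) :
    derivedFormulas A q ⊆ derivedFormulas A (p ++ q) := by
  induction p with
  | nil => exact List.Subset.refl _
  | cons s p ih => exact fun φ hφ => (mem_derivedFormulas_cons A s (p ++ q)).2 (.inr (ih hφ))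

theorem derivedFormulas_subset_append_left (A : List (Formula S))
    (p q : List (Formula S × List (Formula S))) :
    derivedFormulas A p ⊆ derivedFormulas A (p ++ q) := by
  induction p with
  | nil => exact List.nil_subset _
  | cons s p ih =>
    exact fun φ hφ => (mem_derivedFormulas_cons A s (p ++ q)).2 <|
      ((mem_derivedFormulas_cons A s p).1 hφ).imp (.imp_left (·.mono ih)) (ih ·)

theorem exists_mem_derivedFormulas_iff {A : List (Formula S)} {φ : Formula S} :
    (∃ p, φ ∈ derivedFormulas A p) ↔ Derivable {φ | φ ∈ A} φ := by
  have mem_cons {s : Formula S × List (Formula S)} {p : List (Formula S × List (Formula S))}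
      (h : Justified A (derivedFormulas A p) s) : s.1 ∈ derivedFormulas A (s :: p) :=
    (mem_derivedFormulas_cons A s p).2 (.inl ⟨h, rfl⟩)
  constructor
  · rintro ⟨p, hp⟩
    induction p generalizing φ with
    | nil => cases hp
    | cons s p ih =>
      obtain ⟨h, rfl⟩ | h := (mem_derivedFormulas_cons A s p).1 hp
      exacts [h.derivable fun _ => ih, ih h]
  · intro h
    induction h with
    | @ax φ hφ σ =>
      exact ⟨_, mem_cons (s := (_, (List.range (varBound φ)).map σ)) (p := [])
        (.inl ⟨φ, hφ, subst_listSubst_map_range σ φ⟩)⟩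
    | @mp φ ψ _ _ ihimp ih =>
      obtain ⟨p, hp⟩ := ihimp
      obtain ⟨q, hq⟩ := ih
      exact ⟨_, mem_cons (s := (ψ, [])) (.inr (.inl
        ⟨φ, derivedFormulas_subset_append_right A p q hq,
          derivedFormulas_subset_append_left A p q hp⟩))⟩
    | @nec φ e _ ih =>
      obtain ⟨p, hp⟩ := ih
      exact ⟨_, mem_cons (s := (box e φ, [])) (.inr (.inr ⟨φ, hp, e, rfl⟩))⟩

section Enumeration

variable [Primcodable S] [Finite S]

theorem primrecPred_justified (A : List (Formula S)) :
    PrimrecPred fun q : List (Formula S) × Formula S × List (Formula S) =>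
      Justified A q.1 q.2 := by
  have hax : PrimrecPred fun q : List (Formula S) × Formula S × List (Formula S) =>
      ∃ φ ∈ A, φ.subst (listSubst q.2.2) = q.2.1 :=
    primrecPred_exists_mem (Primrec.eq.comp
      (primrec_subst_listSubst.comp (Primrec.snd.comp (Primrec.snd.comp .fst)) .snd)
      (Primrec.fst.comp (Primrec.snd.comp .fst))) (.const A)
  have hmp : PrimrecPred fun q : List (Formula S) × Formula S × List (Formula S) =>
      ∃ φ ∈ q.1, imp φ q.2.1 ∈ q.1 :=
    primrecPred_exists_mem (primrecPred_mem
      (primrec_imp.comp .snd (Primrec.fst.comp (Primrec.snd.comp .fst)))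
      (Primrec.fst.comp .fst)) .fst
  have hnec : PrimrecPred fun q : List (Formula S) × Formula S × List (Formula S) =>
      ∃ φ ∈ q.1, ∃ e ∈ (Set.finite_univ (α := S)).toFinset.toList, box e φ = q.2.1 :=
    primrecPred_exists_mem (primrecPred_exists_mem (Primrec.eq.comp
      (primrec_box.comp .snd (Primrec.snd.comp .fst))
      (Primrec.fst.comp (Primrec.snd.comp (Primrec.fst.comp .fst)))) (.const _)) .fst
  exact (hax.or (hmp.or hnec)).of_eq fun q => by simp [Justified]

theorem primrec_derivedFormulas (A : List (Formula S)) : Primrec (derivedFormulas A) := by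
  classical
  have hstep : Primrec₂ fun (_ : List (Formula S × List (Formula S)))
      (q : (Formula S × List (Formula S)) × List (Formula S)) =>
        if Justified A q.2 q.1 then q.1.1 :: q.2 else q.2 :=
    Primrec.ite ((primrecPred_justified A).comp
        ((Primrec.snd.comp .snd).pair (Primrec.fst.comp .snd)))
      (Primrec.list_cons.comp (Primrec.fst.comp (Primrec.fst.comp .snd)) (Primrec.snd.comp .snd))
      (Primrec.snd.comp .snd)
  exact (Primrec.list_foldr .id (.const []) hstep).of_eq fun p => by
    unfold derivedFormulas; congr!

theorem FinitelyAxiomatizable.rePred {L : Set (Formula S)} (h : FinitelyAxiomatizable L) :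
    REPred (· ∈ L) := by
  obtain ⟨A, hA, rfl⟩ := h
  have hfin : (normalAxioms S ∪ A).Finite :=
    ((by simp [propAxioms] : (propAxioms S).Finite).union (Set.finite_range _)).union hA
  refine (rePred_exists (p := fun φ p => φ ∈ derivedFormulas hfin.toFinset.toList p)
    (primrecPred_mem .fst ((primrec_derivedFormulas _).comp .snd)).computablePred).of_eq
    fun φ => ?_
  rw [exists_mem_derivedFormulas_iff, mem_smallestLogic_iff]
  simp only [Finset.mem_toList, Set.Finite.mem_toFinset, Set.ofPred_mem_eq]

end Enumeration

/-! ### Decision procedures -/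

theorem computablePred_forall_valid [Primcodable S] {A : Set (Formula S)} (hA : A.Finite) :
    ComputablePred fun d => ∀ φ ∈ A, (presentedFrame Encodable.encode d).Valid φ :=
  ((primrecPred_forall_mem (p := fun d φ => (presentedFrame Encodable.encode d).Valid φ)
    primrecPred_presentedFrame_valid (.const hA.toFinset.toList)).of_eq
      fun d => by simp).computablePred

theorem Frame.forall_mem_smallestLogic_valid_iff (F : Frame S W) {A : Set (Formula S)} :
    (∀ φ ∈ smallestLogic A, F.Valid φ) ↔ ∀ φ ∈ A, F.Valid φ :=
  ⟨fun h _ hφ => h _ (subset_smallestLogic A hφ),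
    fun h _ hφ => hφ {φ | F.Valid φ} F.isNormalLogic_valid h⟩

theorem FinitelyAxiomatizable.decidableFiniteFrames [Finite S] {L : Set (Formula S)}
    (h : FinitelyAxiomatizable L) : DecidableFiniteFrames L := by
  obtain ⟨A, hA, rfl⟩ := h
  intro ι hι
  obtain ⟨_, rfl⟩ := exists_primcodable_encode_eq hι
  exact (computablePred_forall_valid hA).of_eq
    fun d => (presentedFrame _ d).forall_mem_smallestLogic_valid_iff.symm

theorem finite_pdlAxiom [Finite S] : {φ : Formula (Sharp S) | PDLAxiom φ}.Finite := by
  refine (((((Set.finite_range fun q : S × S => iff (box (.union q.1 q.2) (var 0))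
      (and (box (.base q.1) (var 0)) (box (.base q.2) (var 0)))).union
    (Set.finite_range fun q : S × S => iff (box (.comp q.1 q.2) (var 0))
      (box (.base q.1) (box (.base q.2) (var 0))))).union
    (Set.finite_range fun e : S => imp (box (.plus e) (var 0)) (box (.base e) (var 0)))).union
    (Set.finite_range fun e : S => imp (box (.plus e) (var 0))
      (box (.base e) (box (.plus e) (var 0))))).union
    (Set.finite_range fun e : S => imp (box (.plus e) (imp (var 0) (box (.base e) (var 0))))
      (imp (box (.base e) (var 0)) (box (.plus e) (var 0))))).subset ?_
  rintro _ (⟨e, c⟩ | ⟨e, c⟩ | e | e | e)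
  exacts [.inl (.inl (.inl (.inl ⟨(e, c), rfl⟩))), .inl (.inl (.inl (.inr ⟨(e, c), rfl⟩))),
    .inl (.inl (.inr ⟨e, rfl⟩)), .inl (.inr ⟨e, rfl⟩), .inr ⟨e, rfl⟩]

theorem base_injective : Function.Injective (Sharp.base : S → Sharp S) :=
  fun _ _ h => Sharp.base.inj h

theorem DecidableFiniteFrames.sharp [Finite S] {L : Set (Formula S)}
    (h : DecidableFiniteFrames L) : DecidableFiniteFrames (sharpLogic L) := by
  intro ι hι
  have hbase := h (ι ∘ Sharp.base) (hι.comp base_injective)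
  obtain ⟨_, rfl⟩ := exists_primcodable_encode_eq hι
  refine (computablePred_and hbase
    (computablePred_forall_valid (finite_pdlAxiom (S := S)))).of_eq fun d => ?_
  rw [sharpLogic, Frame.forall_mem_smallestLogic_valid_iff, Set.union_def]
  simp only [Set.mem_ofPred_eq, or_imp, forall_and, Set.forall_mem_image,
    Frame.valid_mapAlphabet]
  rfl

theorem mapAlphabet_subst (f : S → T) (σ : ℕ → Formula S) (φ : Formula S) :
    (φ.subst σ).mapAlphabet f = (φ.mapAlphabet f).subst fun i => (σ i).mapAlphabet f := by
  induction φ with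
  | bot => rfl
  | var i => rfl
  | imp φ ψ ihφ ihψ => simp only [Formula.subst, mapAlphabet, ihφ, ihψ]
  | box e φ ih => simp only [Formula.subst, mapAlphabet, ih]

theorem IsNormalLogic.comap {L : Set (Formula T)} (hL : IsNormalLogic L) (f : S → T) :
    IsNormalLogic (mapAlphabet f ⁻¹' L) where
  taut φ h := hL.taut _ fun v hbot himp =>
    h (fun ψ => v (ψ.mapAlphabet f)) hbot fun _ _ => himp _ _
  axiomK e := hL.axiomK (f e)
  mp φ ψ := hL.mp _ _
  subst σ φ h := by
    rw [Set.mem_preimage, mapAlphabet_subst]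
    exact hL.subst _ _ h
  nec e φ := hL.nec (f e) _

theorem FinitelyAxiomatizable.sharp [Finite S] {L : Set (Formula S)}
    (h : FinitelyAxiomatizable L) : FinitelyAxiomatizable (sharpLogic L) := by
  obtain ⟨A, hA, rfl⟩ := h
  refine ⟨mapAlphabet .base '' A ∪ {φ | PDLAxiom φ}, (hA.image _).union finite_pdlAxiom, ?_⟩
  apply Set.Subset.antisymm <;> intro φ h L hL hAL <;>
    refine h L hL (Set.union_subset (Set.image_subset_iff.2 ?_) (Set.union_subset_iff.1 hAL).2)
  · exact fun ψ hψ => hψ _ (hL.comap .base)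
      (Set.image_subset_iff.1 (Set.union_subset_iff.1 hAL).1)
  · exact (subset_smallestLogic A).trans
      (Set.image_subset_iff.1 (Set.union_subset_iff.1 hAL).1)

/-- The frame transported along a bijection. -/
def Frame.transport {W' : Type*} (F : Frame S W) (f : W ≃ W') : Frame S W' where
  nonempty := F.nonempty.map f
  rel e x y := F.rel e (f.symm x) (f.symm y)

theorem Frame.sat_transport {W' : Type*} (F : Frame S W) (f : W ≃ W') (V : ℕ → W → Prop)
    (x : W) (φ : Formula S) :
    (Model.mk (F.transport f) fun i y => V i (f.symm y)).Sat (f x) φ ↔ (Model.mk F V).Sat x φ := by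
  induction φ generalizing x with
  | bot => exact Iff.rfl
  | var i => simp only [Model.Sat, Equiv.symm_apply_apply]
  | imp φ ψ ihφ ihψ => exact imp_congr (ihφ x) (ihψ x)
  | box e φ ih => simp [Model.sat_box, ← ih, Frame.transport, f.forall_congr_left]

theorem Frame.valid_transport {W' : Type*} (F : Frame S W) (f : W ≃ W') (φ : Formula S) :
    (F.transport f).Valid φ ↔ F.Valid φ := by
  refine ⟨fun h V x => (F.sat_transport f V x φ).1 (h _ _), fun h V x => ?_⟩
  simpa using (F.sat_transport f (fun i y => V i (f y)) (f.symm x) φ).2 (h _ _)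

theorem exists_presentedFrame_valid_iff [Finite S] [Finite W] {ι : S → ℕ}
    (hι : Function.Injective ι) (F : Frame S W) :
    ∃ d, ∀ φ, (presentedFrame ι d).Valid φ ↔ F.Valid φ := by
  have := F.nonempty
  obtain ⟨n, ⟨f⟩⟩ := Finite.exists_equiv_fin W
  obtain ⟨m, rfl⟩ : ∃ m, n = m + 1 :=
    Nat.exists_eq_add_one.2 (Fin.pos_iff_nonempty.2 (F.nonempty.map f))
  obtain ⟨l, hl⟩ := exists_presentedFrame hι m (F.transport f)
  exact ⟨(m, l), fun φ => by rw [hl, F.valid_transport]⟩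

theorem AdmitsDefinableFiltration.coRESet [Finite S] {L : Set (Formula S)}
    (h : AdmitsDefinableFiltration (Mod.{u} L)) (hL : IsNormalLogic L)
    (hdec : DecidableFiniteFrames L) : CoRESet L := by
  intro ι hι
  have hframes := hdec ι hι
  have hcounter (φ : Formula S) (hφ : φ ∉ L) :
      ∃ d, (∀ ψ ∈ L, (presentedFrame ι d).Valid ψ) ∧ ¬ (presentedFrame ι d).Valid φ := by
    obtain ⟨W, F, _, hFL, hFφ⟩ := h.exists_finite_frame hL hφ
    obtain ⟨d, hd⟩ := exists_presentedFrame_valid_iff hι F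
    exact ⟨d, fun ψ hψ => (hd ψ).2 (hFL ψ hψ), fun hdφ => hFφ ((hd φ).1 hdφ)⟩
  obtain ⟨_, rfl⟩ := exists_primcodable_encode_eq hι
  let Refutes (n : ℕ) (q : Formula S × FramePresentation) : Prop :=
    code Encodable.encode q.1 = n ∧
      (∀ ψ ∈ L, (presentedFrame Encodable.encode q.2).Valid ψ) ∧
      ¬ (presentedFrame Encodable.encode q.2).Valid q.1
  have hrefutes : ComputablePred fun r : ℕ × Formula S × FramePresentation => Refutes r.1 r.2 :=
    computablePred_and
      (Primrec.eq.comp (Primrec.encode.comp (Primrec.fst.comp .snd)) .fst).computablePred <|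
      computablePred_and (computablePred_comp hframes (Computable.snd.comp .snd))
        (primrecPred_presentedFrame_valid.comp
          ((Primrec.snd.comp .snd).pair (Primrec.fst.comp .snd))).not.computablePred
  refine (rePred_exists hrefutes).of_eq fun n => ⟨?_, ?_⟩
  · rintro ⟨⟨φ, d⟩, rfl, hdL, hdφ⟩
    exact ⟨φ, fun hφ => hdφ (hdL φ hφ), rfl⟩
  · rintro ⟨φ, hφ, rfl⟩
    obtain ⟨d, hd⟩ := hcounter φ hφ
    exact ⟨(φ, d), rfl, hd⟩

theorem FinitelyAxiomatizable.decidableSet [Finite S] {L : Set (Formula S)}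
    (h : FinitelyAxiomatizable L) (hco : CoRESet L) : DecidableSet L := by
  intro ι hι
  have hcoι := hco ι hι
  obtain ⟨_, rfl⟩ := exists_primcodable_encode_eq hι
  have hcompl : REPred fun φ : Formula S => ¬ φ ∈ L :=
    (rePred_comp hcoι Primrec.encode.to_comp).of_eq fun φ =>
      ⟨fun ⟨ψ, hψ, hψφ⟩ => code_injective hι hψφ ▸ hψ, fun hφ => ⟨φ, hφ, rfl⟩⟩
  exact computablePred_exists_encode_eq
    (ComputablePred.computable_iff_re_compl_re'.2 ⟨h.rePred, hcompl⟩)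

/-! ### Iterated expansions -/

theorem IsNormalLogic.iterLogic {L : Set (Formula S)} (hL : IsNormalLogic L) :
    ∀ n, IsNormalLogic (iterLogic L n)
  | 0 => hL
  | _ + 1 => isNormalLogic_smallestLogic _

theorem AdmitsDefinableFiltration.iterLogic [Finite S] {L : Set (Formula S)}
    (h : AdmitsDefinableFiltration (Mod.{u} L)) (hL : IsNormalLogic L) :
    ∀ n, AdmitsDefinableFiltration (Mod.{u} (iterLogic L n))
  | 0 => h
  | n + 1 => (h.iterLogic hL n).sharp (hL.iterLogic n)

theorem FinitelyAxiomatizable.iterLogic [Finite S] {L : Set (Formula S)}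
    (h : FinitelyAxiomatizable L) : ∀ n, FinitelyAxiomatizable (iterLogic L n)
  | 0 => h
  | n + 1 => (h.iterLogic n).sharp

theorem DecidableFiniteFrames.iterLogic [Finite S] {L : Set (Formula S)}
    (h : DecidableFiniteFrames L) : ∀ n, DecidableFiniteFrames (iterLogic L n)
  | 0 => h
  | n + 1 => (h.iterLogic n).sharp

end ModalLogic

theorem mainTheorem3 {S : Type} [Finite S] (L : Set (ModalLogic.Formula S))
    (hL : ModalLogic.IsNormalLogic L)
    (hADF : ModalLogic.AdmitsDefinableFiltration (ModalLogic.Mod.{u} L)) (n : ℕ) :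
    ModalLogic.AdmitsDefinableFiltration (ModalLogic.Mod.{u} (ModalLogic.iterLogic L n)) ∧
    (ModalLogic.HasFMP.{u} (ModalLogic.iterLogic L n) ∧
      ModalLogic.KripkeComplete.{u} (ModalLogic.iterLogic L n)) ∧
    (ModalLogic.FinitelyAxiomatizable L → ModalLogic.DecidableSet (ModalLogic.iterLogic L n)) ∧
    (ModalLogic.DecidableFiniteFrames L → ModalLogic.CoRESet (ModalLogic.iterLogic L n)) := by
  have hLn := hL.iterLogic n
  have hn := hADF.iterLogic hL n
  have hfmp := hn.hasFMP hLn
  refine ⟨hn, ⟨hfmp, hfmp.kripkeComplete⟩, fun hfin => ?_, fun hdec => ?_⟩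
  · exact (hfin.iterLogic n).decidableSet
      (hn.coRESet hLn (hfin.iterLogic n).decidableFiniteFrames)
  · exact hn.coRESet hLn (hdec.iterLogic n)
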